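/- Let $A$ be a finite alphabet with the discrete topology and let $\sigma\colon A^*\to A^*$ be an endomorphism of the free monoid $A^*$, where $\sigma(a)$ is allowed to be the empty word for some letters $a$. For $x\in A^{\mathbb Z}$, let $\mathcal L(x)$ denote the set of all finite factors of $x$. Let $\mathcal L(\sigma)$ be the set of all factors of the words $\sigma^n(a)$ with $n\ge 0$ and $a\in A$, and let $\mathsf X(\sigma)$ be the shift space of all $x\in A^{\mathbb Z}$ with $\mathcal L(x)\subseteq\mathcal L(\sigma)$. A shift space is a closed subset $Y$ of $A^{\mathbb Z}$ that satisfies $S(Y)=Y$, where $S$ is the shift; it is quasi-minimal if it contains only finitely many shift spaces. Then $\mathsf X(\sigma)$ is quasi-minimal, that is, the set of shift spaces $Y\subseteq \mathsf X(\sigma)$ is finite; equivalently, the set of languages $\{\mathcal L(x)\mid x\in \mathsf X(\sigma)\}$ is finite, and this holds as well. -/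

import Mathlib

open SymbolicDynamics.FullShift

namespace SubstShift

variable {A : Type*}

/-- The word `x_i x_{i+1} ⋯ x_{i+n-1}` of the two-sided infinite sequence `x`. -/
def block (x : ℤ → A) (i : ℤ) (n : ℕ) : List A :=
  List.ofFn fun k : Fin n => x (i + (k : ℤ))

/-- The language `L(x)`: the set of all (finite) factors of the sequence `x`. -/
def seqLanguage (x : ℤ → A) : Set (List A) :=
  {w | ∃ (i : ℤ) (n : ℕ), w = block x i n}

/-- The language `L(σ)` of an endomorphism of `A^*`: all factors of the words `σ^n(a)`,
for `n ≥ 0` and `a ∈ A`. Letters may be erased by `σ`. -/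
def endLanguage (σ : Monoid.End (FreeMonoid A)) : Set (List A) :=
  {w | ∃ (n : ℕ) (a : A), w <:+: FreeMonoid.toList ((σ ^ n) (FreeMonoid.of a))}

/-- The shift `X(σ)`: all two-sided infinite sequences whose factors all lie in `L(σ)`. -/
def substitutionShift [TopologicalSpace A] [DiscreteTopology A]
    (σ : Monoid.End (FreeMonoid A)) : Subshift A ℤ where
  carrier := {x | seqLanguage x ⊆ endLanguage σ}
  isClosed := by
    have h : {x : ℤ → A | seqLanguage x ⊆ endLanguage σ} =
        ⋂ (i : ℤ) (n : ℕ), (fun (x : ℤ → A) (k : Fin n) => x (i + (k : ℤ))) ⁻¹'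
          {u | List.ofFn u ∈ endLanguage σ} := by
      ext x
      simp only [Set.mem_ofPred_eq, Set.mem_iInter, Set.mem_preimage]
      constructor
      · intro hx i n
        exact hx ⟨i, n, rfl⟩
      · rintro hx w ⟨i, n, rfl⟩
        exact hx i n
    rw [h]
    refine isClosed_iInter fun i => isClosed_iInter fun n => ?_
    refine IsClosed.preimage ?_ (isClosed_discrete _)
    exact continuous_pi fun k => continuous_apply _
  mapsTo := by
    rintro g x hx w ⟨i, n, rfl⟩
    refine hx ⟨g + i, n, ?_⟩
    simp only [block, shift_apply, add_assoc]

/-- A shift space is quasi-minimal if it has only finitely many subshifts. -/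
def QuasiMinimal [TopologicalSpace A] (X : Subshift A ℤ) : Prop :=
  {Y : Subshift A ℤ | Y.carrier ⊆ X.carrier}.Finite

end SubstShift

/-! A subshift is determined by the set of languages of its points
(`mem_subshift_of_seqLanguage_subset`), so it is enough that the points of the shift have finitely
many languages.

Erasing letters are removed in `finite_seqLanguage_of_map`: every point is the image under a
nonerasing `φ` of a point generated by a morphism `ρ` whose letters are either fixed or never return
to themselves alone, and its language depends only on that of the preimage.
`finite_seqLanguage_of_seed` replaces `ρ` by a power for which taking the first or last moving (that
is, nonfixed) letter of an image is idempotent; this is `IsSplit`.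

For such a morphism, consider a run of fixed letters between moving letters `g` and `h`. Applying
the morphism adds a constant word on either side once the border letters are stable, so the run has
the form `v^k z u^k` with `z` in a finite set (`exists_gap_eq`). Hence points made of fixed letters
have finitely many languages (`seqLanguage_eq_pumpLanguage`).

A point with a moving letter at the origin is desubstituted infinitely often, by compactness
(`exists_desub`). The iterated images of single letters that cover the origin form increasing
intervals. If these exhaust `ℤ`, the language is that of the iterates of one letter. If they stop on
the right, the same moving letter `g` stands at the border at all late levels, followed either by a
run and a moving letter or by a periodic continuation of a run; finitely many data describe the
language (`seqLanguage_eq_of_moving`, `seqLanguage_eq_of_fixed`). Stopping on the left is the mirror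
image. -/

namespace SubstShift

/-! ### Words occurring in a two-sided sequence -/

section Occurrences

variable {A : Type*}

@[simp] theorem length_block (x : ℤ → A) (i : ℤ) (n : ℕ) : (block x i n).length = n := by
  simp [block]

@[simp] theorem getElem_block (x : ℤ → A) (i : ℤ) (n k : ℕ) (h : k < (block x i n).length) :
    (block x i n)[k] = x (i + k) := by
  simp [block]

@[simp] theorem block_zero (x : ℤ → A) (i : ℤ) : block x i 0 = [] := by
  simp [block]

theorem block_add (x : ℤ → A) (i : ℤ) (m n : ℕ) :
    block x i (m + n) = block x i m ++ block x (i + m) n := by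
  apply List.ext_getElem
  · simp
  · intro k h₁ h₂
    rw [List.getElem_append]
    split_ifs with h
    · simp
    · simp only [length_block, not_lt] at h
      simp only [getElem_block, length_block]
      congr 1
      push_cast [h]
      ring

@[simp] theorem block_one (x : ℤ → A) (i : ℤ) : block x i 1 = [x i] := by
  simp [block]

theorem block_succ (x : ℤ → A) (i : ℤ) (n : ℕ) :
    block x i (n + 1) = x i :: block x (i + 1) n := by
  rw [add_comm, block_add]; simp

theorem mem_block {x : ℤ → A} {i : ℤ} {n : ℕ} {a : A} :
    a ∈ block x i n ↔ ∃ k : ℕ, k < n ∧ x (i + k) = a := by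
  rw [List.mem_iff_getElem]
  constructor
  · rintro ⟨k, hk, rfl⟩
    exact ⟨k, by simpa using hk, by simp⟩
  · rintro ⟨k, hk, rfl⟩
    exact ⟨k, by simpa using hk, by simp⟩

/-- The word `w` occurs in `x` at position `i`. -/
def Occurs (x : ℤ → A) (i : ℤ) (w : List A) : Prop :=
  block x i w.length = w

theorem occurs_block (x : ℤ → A) (i : ℤ) (n : ℕ) : Occurs x i (block x i n) := by
  simp [Occurs]

theorem occurs_append {x : ℤ → A} {i : ℤ} {u v : List A} :
    Occurs x i (u ++ v) ↔ Occurs x i u ∧ Occurs x (i + u.length) v := by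
  unfold Occurs
  rw [List.length_append, block_add]
  constructor
  · intro h
    exact List.append_inj h (by simp)
  · rintro ⟨h₁, h₂⟩
    rw [h₁, h₂]

@[simp] theorem occurs_nil (x : ℤ → A) (i : ℤ) : Occurs x i [] := by
  simp [Occurs]

@[simp] theorem occurs_singleton {x : ℤ → A} {i : ℤ} {a : A} : Occurs x i [a] ↔ x i = a := by
  simp [Occurs]

theorem occurs_cons {x : ℤ → A} {i : ℤ} {a : A} {w : List A} :
    Occurs x i (a :: w) ↔ x i = a ∧ Occurs x (i + 1) w := by
  rw [← List.singleton_append, occurs_append]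
  simp

theorem Occurs.mem_seqLanguage {x : ℤ → A} {i : ℤ} {w : List A} (h : Occurs x i w) :
    w ∈ seqLanguage x :=
  ⟨i, w.length, h.symm⟩

theorem mem_seqLanguage {x : ℤ → A} {w : List A} : w ∈ seqLanguage x ↔ ∃ i, Occurs x i w := by
  constructor
  · rintro ⟨i, n, rfl⟩
    exact ⟨i, occurs_block x i n⟩
  · rintro ⟨i, h⟩
    exact h.mem_seqLanguage

theorem Occurs.exists_of_infix {x : ℤ → A} {i : ℤ} {u w : List A} (h : Occurs x i w)
    (hu : u <:+: w) : ∃ j, Occurs x j u := by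
  obtain ⟨p, q, rfl⟩ := hu
  rw [occurs_append, occurs_append] at h
  exact ⟨_, h.1.2⟩

theorem mem_seqLanguage_of_infix {x : ℤ → A} {u w : List A} (hw : w ∈ seqLanguage x)
    (hu : u <:+: w) : u ∈ seqLanguage x := by
  obtain ⟨i, hi⟩ := mem_seqLanguage.1 hw
  exact mem_seqLanguage.2 (hi.exists_of_infix hu)

/-- A word occurring in `x` inside a range where `w` occurs is a factor of `w`. -/
theorem Occurs.infix_of_le {x : ℤ → A} {i j : ℤ} {u w : List A} (hw : Occurs x i w)
    (hu : Occurs x j u) (hij : i ≤ j) (hle : j + u.length ≤ i + w.length) : u <:+: w := by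
  obtain ⟨p, hp⟩ := Int.eq_ofNat_of_zero_le (sub_nonneg.2 hij)
  obtain ⟨q, hq⟩ := Int.eq_ofNat_of_zero_le (sub_nonneg.2 hle)
  have hlen : w.length = p + u.length + q := by omega
  unfold Occurs at hw hu
  rw [hlen, block_add, block_add] at hw
  have hj : i + (p : ℤ) = j := by omega
  rw [hj, hu] at hw
  exact ⟨_, _, hw⟩

theorem infix_block {x : ℤ → A} {i j : ℤ} {m n : ℕ} (hij : i ≤ j) (hle : j + m ≤ i + n) :
    block x j m <:+: block x i n :=
  (occurs_block x i n).infix_of_le (occurs_block x j m) hij (by simpa using hle)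

theorem Occurs.mem_iff {x : ℤ → A} {i : ℤ} {w : List A} {a : A} (h : Occurs x i w) :
    a ∈ w ↔ ∃ k : ℕ, k < w.length ∧ x (i + k) = a := by
  conv_lhs => rw [← h]
  exact mem_block

theorem Occurs.mem_of_lt {x : ℤ → A} {i j : ℤ} {w : List A} (h : Occurs x i w) (hij : i ≤ j)
    (hj : j < i + w.length) : x j ∈ w := by
  rw [h.mem_iff]
  refine ⟨(j - i).toNat, by omega, ?_⟩
  congr 1
  omega

/-- If `w` and `u` occur at the same place, then the shorter one is a prefix. -/
theorem Occurs.prefix_of_le {x : ℤ → A} {i : ℤ} {u w : List A} (hw : Occurs x i w)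
    (hu : Occurs x i u) (hle : u.length ≤ w.length) : u <+: w := by
  obtain ⟨q, hq⟩ := Nat.exists_eq_add_of_le hle
  unfold Occurs at hw hu
  rw [hq, block_add, hu] at hw
  exact ⟨_, hw⟩

theorem Occurs.of_prefix {x : ℤ → A} {i : ℤ} {u w : List A} (hw : Occurs x i w)
    (hu : u <+: w) : Occurs x i u := by
  obtain ⟨q, rfl⟩ := hu
  exact (occurs_append.1 hw).1

end Occurrences

/-! ### Morphisms of free monoids, as maps on lists -/

section WordMap

variable {A B D : Type*}

/-- The morphism of free monoids extending the map `s` on letters. -/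
def wordMap (s : A → List B) (w : List A) : List B :=
  w.flatMap s

@[simp] theorem wordMap_nil (s : A → List B) : wordMap s [] = [] := rfl

@[simp] theorem wordMap_append (s : A → List B) (u v : List A) :
    wordMap s (u ++ v) = wordMap s u ++ wordMap s v := by
  simp [wordMap]

@[simp] theorem wordMap_cons (s : A → List B) (a : A) (w : List A) :
    wordMap s (a :: w) = s a ++ wordMap s w := by
  simp [wordMap]

theorem wordMap_singleton (s : A → List B) (a : A) : wordMap s [a] = s a := by
  simp

theorem mem_wordMap {s : A → List B} {w : List A} {b : B} :
    b ∈ wordMap s w ↔ ∃ a ∈ w, b ∈ s a := by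
  simp [wordMap]

theorem wordMap_congr {s t : A → List B} {w : List A} (h : ∀ a ∈ w, s a = t a) :
    wordMap s w = wordMap t w := by
  induction w with
  | nil => rfl
  | cons a w ih =>
    simp only [wordMap_cons]
    rw [h a (by simp), ih fun b hb => h b (by simp [hb])]

theorem wordMap_wordMap (s : B → List D) (t : A → List B) (w : List A) :
    wordMap s (wordMap t w) = wordMap (fun a => wordMap s (t a)) w := by
  induction w with
  | nil => rfl
  | cons a w ih => simp [ih]

theorem wordMap_of_fixed {s : A → List A} {w : List A} (h : ∀ a ∈ w, s a = [a]) :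
    wordMap s w = w := by
  induction w with
  | nil => rfl
  | cons a w ih =>
    simp only [wordMap_cons]
    rw [h a (by simp), ih fun b hb => h b (by simp [hb])]
    rfl

theorem length_le_length_wordMap {s : A → List B} (hs : ∀ a, s a ≠ []) (w : List A) :
    w.length ≤ (wordMap s w).length := by
  induction w with
  | nil => simp
  | cons a w ih =>
    have := List.length_pos_iff.2 (hs a)
    simp only [wordMap_cons, List.length_cons, List.length_append]
    omega

theorem length_wordMap_le {s : A → List B} {M : ℕ} (hM : ∀ a, (s a).length ≤ M) (w : List A) :
    (wordMap s w).length ≤ M * w.length := by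
  induction w with
  | nil => simp
  | cons a w ih =>
    have := hM a
    simp only [wordMap_cons, List.length_cons, List.length_append]
    rw [Nat.mul_succ]
    omega

theorem iterate_wordMap_append (s : A → List A) (n : ℕ) (u v : List A) :
    (wordMap s)^[n] (u ++ v) = (wordMap s)^[n] u ++ (wordMap s)^[n] v := by
  induction n generalizing u v with
  | zero => rfl
  | succ n ih => simp [ih]

@[simp] theorem iterate_wordMap_nil (s : A → List A) (n : ℕ) : (wordMap s)^[n] [] = [] := by
  induction n with
  | zero => rfl
  | succ n ih => simp [ih]

theorem iterate_wordMap_infix (s : A → List A) (n : ℕ) {u w : List A} (h : u <:+: w) :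
    (wordMap s)^[n] u <:+: (wordMap s)^[n] w := by
  obtain ⟨p, q, rfl⟩ := h
  exact ⟨(wordMap s)^[n] p, (wordMap s)^[n] q, by simp [iterate_wordMap_append]⟩

/-- Iterating the morphism `s` is the morphism given by the iterated images of the letters. -/
theorem iterate_wordMap_eq (s : A → List A) (n : ℕ) :
    (wordMap s)^[n] = wordMap fun a => (wordMap s)^[n] [a] := by
  funext w
  induction w with
  | nil => simp
  | cons a w ih =>
    rw [← List.singleton_append, iterate_wordMap_append, ih]
    simp

theorem length_le_length_iterate_wordMap {s : A → List A} (hs : ∀ a, s a ≠ []) (n : ℕ)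
    (w : List A) : w.length ≤ ((wordMap s)^[n] w).length := by
  induction n generalizing w with
  | zero => simp
  | succ n ih => exact (length_le_length_wordMap hs w).trans (ih _)

/-- The set of factors of the iterated images of a word. -/
def orbitLanguage (s : A → List A) (w : List A) : Set (List A) :=
  {t | ∃ n, t <:+: (wordMap s)^[n] w}

theorem orbitLanguage_of_infix {s : A → List A} {w t u : List A} (ht : t ∈ orbitLanguage s w)
    (hu : u <:+: t) : u ∈ orbitLanguage s w := by
  obtain ⟨n, hn⟩ := ht
  exact ⟨n, hu.trans hn⟩

theorem iterate_wordMap_infix_of_le {s : A → List A} {w : List A} (hw : w <:+: wordMap s w)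
    {m n : ℕ} (hmn : m ≤ n) : (wordMap s)^[m] w <:+: (wordMap s)^[n] w := by
  induction n, hmn using Nat.le_induction with
  | base => exact List.infix_rfl
  | succ n _ ih => exact ih.trans (by simpa using iterate_wordMap_infix s n hw)

end WordMap

/-! ### Desubstitution of two-sided sequences -/

section Desubstitution

variable {A B : Type*}

/-- The sequence `x` is the image of `y` under the morphism `φ`, where the image of the letter
`y i` starts at position `c i` of `x`. -/
def Desub (φ : B → List A) (x : ℤ → A) (y : ℤ → B) (c : ℤ → ℤ) : Prop :=
  ∀ i, c (i + 1) = c i + (φ (y i)).length ∧ Occurs x (c i) (φ (y i))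

theorem Desub.occurs {φ : B → List A} {x : ℤ → A} {y : ℤ → B} {c : ℤ → ℤ} (h : Desub φ x y c)
    {i : ℤ} {w : List B} (hw : Occurs y i w) :
    Occurs x (c i) (wordMap φ w) ∧ c (i + w.length) = c i + (wordMap φ w).length := by
  induction w generalizing i with
  | nil => simp
  | cons b w ih =>
    rw [occurs_cons] at hw
    obtain ⟨h₁, h₂⟩ := ih hw.2
    obtain ⟨h₃, h₄⟩ := h i
    rw [hw.1] at h₃ h₄
    rw [h₃] at h₁ h₂
    simp only [wordMap_cons, List.length_cons, List.length_append, Nat.cast_add, Nat.cast_one]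
    refine ⟨occurs_append.2 ⟨h₄, h₁⟩, ?_⟩
    rw [add_comm (w.length : ℤ) 1, ← add_assoc, h₂]
    ring

theorem Desub.add_le {φ : B → List A} (hφ : ∀ b, φ b ≠ []) {x : ℤ → A} {y : ℤ → B} {c : ℤ → ℤ}
    (h : Desub φ x y c) (i : ℤ) (n : ℕ) : c i + n ≤ c (i + n) := by
  have h₁ := (h.occurs (occurs_block y i n)).2
  have h₂ := length_le_length_wordMap hφ (block y i n)
  rw [length_block] at h₁ h₂
  omega

theorem Desub.strictMono {φ : B → List A} (hφ : ∀ b, φ b ≠ []) {x : ℤ → A} {y : ℤ → B}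
    {c : ℤ → ℤ} (h : Desub φ x y c) : StrictMono c := by
  intro i j hij
  have := h.add_le hφ i (j - i).toNat
  have hj : i + ((j - i).toNat : ℤ) = j := by omega
  rw [hj] at this
  omega

/-- The language of a morphic image is the set of factors of images of words. -/
theorem Desub.seqLanguage_eq {φ : B → List A} (hφ : ∀ b, φ b ≠ []) {x : ℤ → A} {y : ℤ → B}
    {c : ℤ → ℤ} (h : Desub φ x y c) :
    seqLanguage x = {t | ∃ w ∈ seqLanguage y, t <:+: wordMap φ w} := by
  ext t
  constructor
  · rintro ⟨i, n, rfl⟩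
    -- Each letter advances the cut by at least one, so `N` letters on each side of the origin reach
    -- both ends of the block.
    let N : ℕ := (c 0 - i).toNat + (i + n - c 0).toNat
    refine ⟨block y (-N) (N + N), ⟨_, _, rfl⟩, ?_⟩
    obtain ⟨h₁, h₂⟩ := h.occurs (occurs_block y (-N) (N + N))
    have h₃ := h.add_le hφ (-N) N
    have h₄ := h.add_le hφ 0 N
    rw [length_block] at h₂
    have e₁ : (-N : ℤ) + ((N + N : ℕ) : ℤ) = 0 + N := by push_cast; ring
    have e₂ : (-N : ℤ) + N = 0 := by ring
    rw [e₁] at h₂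
    rw [e₂] at h₃
    refine h₁.infix_of_le (occurs_block x i n) ?_ ?_
    · omega
    · rw [length_block]; omega
  · rintro ⟨w, hw, ht⟩
    obtain ⟨i, hi⟩ := mem_seqLanguage.1 hw
    exact mem_seqLanguage_of_infix (h.occurs hi).1.mem_seqLanguage ht

theorem exists_prefix_wordMap {φ : B → List A} {M : ℕ} (hM : ∀ b, (φ b).length ≤ M) {w : List B}
    {t : List A} (ht : t <+: wordMap φ w) :
    ∃ w' q, w' <+: w ∧ t = wordMap φ w' ++ q ∧ q.length ≤ M := by
  induction w generalizing t with
  | nil => exact ⟨[], [], List.nil_prefix, by simpa using ht, by simp⟩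
  | cons b w ih =>
    rw [wordMap_cons] at ht
    rcases le_total t.length (φ b).length with h | h
    · exact ⟨[], t, List.nil_prefix, by simp, h.trans (hM b)⟩
    · obtain ⟨t', rfl⟩ := List.prefix_of_prefix_length_le (List.prefix_append _ _) ht h
      rw [List.prefix_append_right_inj] at ht
      obtain ⟨w', q, h₁, rfl, h₃⟩ := ih ht
      exact ⟨b :: w', q, by simpa using h₁, by simp, h₃⟩

/-- A factor of the image of a word is the image of a factor, up to bounded words at the ends. -/
theorem exists_infix_wordMap {φ : B → List A} {M : ℕ} (hM : ∀ b, (φ b).length ≤ M) {w : List B}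
    {t : List A} (ht : t <:+: wordMap φ w) :
    ∃ p w' q, w' <:+: w ∧ t = p ++ (wordMap φ w' ++ q) ∧ p.length ≤ M ∧ q.length ≤ M := by
  induction w generalizing t with
  | nil => exact ⟨[], [], [], List.nil_infix, by simpa using ht, by simp, by simp⟩
  | cons b w ih =>
    rw [wordMap_cons, List.infix_append_iff] at ht
    rcases ht with ht | ht | ⟨t₁, t₂, rfl, h₁, h₂⟩
    · exact ⟨t, [], [], List.nil_infix, by simp, ht.length_le.trans (hM b), by simp⟩
    · obtain ⟨p, w', q, h₁, h₂⟩ := ih ht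
      exact ⟨p, w', q, h₁.trans (List.suffix_cons _ _).isInfix, h₂⟩
    · obtain ⟨w', q, h₃, rfl, h₄⟩ := exists_prefix_wordMap hM h₂
      exact ⟨t₁, w', q, h₃.isInfix.trans (List.suffix_cons _ _).isInfix, rfl,
        h₁.length_le.trans (hM b), h₄⟩

/-- Singles out the letter `b` whose image covers position `0` when the image of `w` starts at `s`.
-/
theorem exists_split_wordMap {φ : B → List A} (w : List B) {s : ℤ} (hs : s ≤ 0)
    (hw : 0 < s + (wordMap φ w).length) :
    ∃ l b r, w = l ++ b :: r ∧ s + (wordMap φ l).length ≤ 0 ∧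
      0 < s + (wordMap φ l).length + (φ b).length := by
  induction w generalizing s with
  | nil => simp at hw; omega
  | cons b w ih =>
    by_cases h : 0 < s + (φ b).length
    · exact ⟨[], b, w, rfl, by simpa using hs, by simpa using h⟩
    · rw [wordMap_cons, List.length_append] at hw
      obtain ⟨l, b', r, rfl, h₁, h₂⟩ := ih (s := s + (φ b).length) (by omega)
        (by push_cast at hw; omega)
      refine ⟨b :: l, b', r, rfl, ?_, ?_⟩ <;> simp only [wordMap_cons, List.length_append] <;>
        push_cast <;> omega

/-- The starting position of the image of the letter `y i`, when the image of `y 0` starts at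
position `o`. -/
def cutPos (φ : B → List A) (y : ℤ → B) (o i : ℤ) : ℤ :=
  if 0 ≤ i then o + (wordMap φ (block y 0 i.toNat)).length
  else o - (wordMap φ (block y i (-i).toNat)).length

@[simp] theorem cutPos_zero (φ : B → List A) (y : ℤ → B) (o : ℤ) : cutPos φ y o 0 = o := by
  simp [cutPos]

theorem cutPos_succ (φ : B → List A) (y : ℤ → B) (o i : ℤ) :
    cutPos φ y o (i + 1) = cutPos φ y o i + (φ (y i)).length := by
  unfold cutPos
  by_cases h : 0 ≤ i
  · rw [if_pos h, if_pos (by omega), show (i + 1).toNat = i.toNat + 1 by omega, block_add]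
    simp only [zero_add, block_one, wordMap_append, wordMap_singleton, List.length_append,
      Int.toNat_of_nonneg h]
    push_cast
    ring
  · rw [if_neg h, show (-i).toNat = (-(i + 1)).toNat + 1 by omega, block_succ, wordMap_cons,
      List.length_append]
    split_ifs with h'
    · obtain rfl : i = -1 := by omega
      simp
    · push_cast
      ring

theorem cutPos_add (φ : B → List A) (y : ℤ → B) (o i : ℤ) (n : ℕ) :
    cutPos φ y o (i + n) = cutPos φ y o i + (wordMap φ (block y i n)).length := by
  induction n with
  | zero => simp
  | succ n ih =>
    rw [block_add, wordMap_append, List.length_append, Nat.cast_add, Nat.cast_one, ← add_assoc,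
      cutPos_succ, ih]
    simp only [block_one, wordMap_singleton]
    push_cast
    ring

/-- Locality of the cuts; it lets them pass to a pointwise limit of sequences. -/
theorem cutPos_congr (φ : B → List A) {y z : ℤ → B} (o : ℤ) {i : ℤ}
    (h : ∀ j, -|i| ≤ j → j < |i| → y j = z j) : cutPos φ y o i = cutPos φ z o i := by
  have key : ∀ (k : ℤ) (n : ℕ), -|i| ≤ k → k + n ≤ |i| → block y k n = block z k n := by
    intro k n h₁ h₂
    apply List.ext_getElem (by simp)
    intro m h₃ h₄
    rw [length_block] at h₃
    simp only [getElem_block]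
    exact h _ (by omega) (by omega)
  unfold cutPos
  split_ifs with hi
  · rw [key _ _ (by simp) (by rw [abs_of_nonneg hi]; omega)]
  · rw [key _ _ (by rw [abs_of_neg (by omega)]; omega) (by rw [abs_of_neg (by omega)]; omega)]

/-- Finite-window form of desubstitution: a long central block of `x` lies in some `φ w`, and the
letter covering the origin is kept with `I` neighbours on each side. The bounds on `o` do not depend
on `I`, which makes a limit possible. -/
theorem exists_local_desub {φ : B → List A} {M : ℕ}
    (hM : ∀ b, (φ b).length ≤ M) {L : Set (List B)}
    (hL : ∀ w ∈ L, ∀ u, u <:+: w → u ∈ L) {x : ℤ → A}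
    (hx : ∀ t ∈ seqLanguage x, ∃ w ∈ L, t <:+: wordMap φ w) (I : ℕ) :
    ∃ (y : ℤ → B) (o : ℤ), o ∈ Set.Icc (-(M : ℤ)) 0 ∧ 0 < o + (φ (y 0)).length ∧
      block y (-I) (I + 1 + I) ∈ L ∧
      ∀ i : ℤ, |i| ≤ I → Occurs x (cutPos φ y o i) (φ (y i)) := by
  -- On each side, `M` positions may be lost to the ragged end and `M` to the image of the central
  -- letter; more than `M * I` remain, hence at least `I` letters.
  let N : ℕ := M * (I + 2) + 1
  obtain ⟨w₀, hw₀, ht⟩ := hx (block x (-N) (N + N)) ⟨_, _, rfl⟩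
  obtain ⟨p, w, q, hw, hpq, hp, hq⟩ := exists_infix_wordMap hM ht
  have hlen := congrArg List.length hpq
  simp only [length_block, List.length_append] at hlen
  have hocc := occurs_block x (-N) (N + N)
  rw [hpq, occurs_append, occurs_append] at hocc
  have hNM : (N : ℤ) = M * I + 2 * M + 1 := by simp only [N]; push_cast; ring
  have hMI : (0 : ℤ) ≤ M * I := by positivity
  obtain ⟨l, b, r, rfl, hl, hb⟩ := exists_split_wordMap (φ := φ) w (s := -N + p.length)
    (by omega) (by omega)
  have hbM := hM b
  have hocc' := hocc.2.1
  simp only [wordMap_append, wordMap_cons, List.length_append] at hlen hocc'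
  have hlI : I ≤ l.length := by
    have := length_wordMap_le hM l
    zify at this
    by_contra hlt
    push Not at hlt
    have h₁ : (M : ℤ) * l.length ≤ M * I := by gcongr
    omega
  have hrI : I ≤ r.length := by
    have := length_wordMap_le hM r
    zify at this
    by_contra hlt
    push Not at hlt
    have h₁ : (M : ℤ) * r.length ≤ M * I := by gcongr
    omega
  obtain ⟨l₁, l₂, rfl, hl₂⟩ : ∃ l₁ l₂, l = l₁ ++ l₂ ∧ l₂.length = I :=
    ⟨l.take (l.length - I), l.drop (l.length - I), (List.take_append_drop _ _).symm, by
      simp; omega⟩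
  obtain ⟨r₁, r₂, rfl, hr₁⟩ : ∃ r₁ r₂, r = r₁ ++ r₂ ∧ r₁.length = I :=
    ⟨r.take I, r.drop I, (List.take_append_drop _ _).symm, by simp; omega⟩
  have hwL : l₂ ++ b :: r₁ ∈ L := hL _ hw₀ _ <| List.IsInfix.trans ⟨l₁, r₂, by simp⟩ hw
  -- Only the window from `-I` to `I` matters; the values outside it are arbitrary.
  let y : ℤ → B := fun i => (l₂ ++ b :: r₁).getD (I + i).toNat b
  have hlen' : (l₂ ++ b :: r₁).length = I + 1 + I := by simp; omega
  have hy : block y (-I) (I + 1 + I) = l₂ ++ b :: r₁ := by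
    apply List.ext_getElem
    · simp only [length_block, hlen']
    · intro k h₁ h₂
      simp only [getElem_block, y]
      rw [List.getD_eq_getElem?_getD, show ((I : ℤ) + (-I + k)).toNat = k by omega,
        List.getElem?_eq_getElem h₂]
      rfl
  have hy' : Occurs y (-I) (l₂ ++ b :: r₁) := by
    rw [← hy]; exact occurs_block _ _ _
  rw [occurs_append, occurs_cons, hl₂] at hy'
  have hy0 : y 0 = b := by
    rw [← hy'.2.1]; congr 1; ring
  have hyl : block y (-I) I = l₂ := by
    have := hy'.1
    unfold Occurs at this
    rwa [hl₂] at this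
  set o : ℤ := -N + p.length + (wordMap φ (l₁ ++ l₂)).length with ho
  refine ⟨y, o, ⟨by omega, hl⟩, by rw [hy0]; exact hb, by rw [hy]; exact hwL, ?_⟩
  have hcI : cutPos φ y o (-I) + (wordMap φ l₂).length = o := by
    have := cutPos_add φ y o (-I) I
    rw [hyl, neg_add_cancel, cutPos_zero] at this
    exact this.symm
  have hbig : Occurs x (cutPos φ y o (-I)) (wordMap φ (block y (-I) (I + 1 + I))) := by
    rw [hy]
    have h₁ : wordMap φ (l₁ ++ l₂) ++ (φ b ++ wordMap φ (r₁ ++ r₂)) =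
        wordMap φ l₁ ++ (wordMap φ (l₂ ++ b :: r₁) ++ wordMap φ r₂) := by simp
    rw [h₁, occurs_append, occurs_append] at hocc'
    convert hocc'.2.1 using 1
    rw [wordMap_append, List.length_append] at ho
    push_cast at ho
    omega
  intro i hi
  rw [abs_le] at hi
  obtain ⟨n, hn⟩ := Int.eq_ofNat_of_zero_le (show 0 ≤ i + I by omega)
  obtain ⟨m, hm⟩ := Nat.exists_eq_add_of_le (show n + 1 ≤ I + 1 + I by omega)
  have hin : i = -I + n := by omega
  rw [hm, block_add, block_add, block_one, ← hin] at hbig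
  simp only [wordMap_append, occurs_append, wordMap_singleton] at hbig
  rw [hin, cutPos_add, ← hin]
  exact hbig.1.2

/-- Pigeonhole along an ultrafilter, used throughout in place of extracting subsequences. -/
theorem exists_eventually_eq_of_finite {X : Type*} (U : Ultrafilter ℕ) {S : Set X} (hS : S.Finite)
    (f : ℕ → X) (hf : ∀ n, f n ∈ S) : ∃ v ∈ S, ∀ᶠ n in U, f n = v := by
  obtain ⟨v, hv, h⟩ := Ultrafilter.eq_pure_of_finite_mem (f := U.map f) hS
    (show f ⁻¹' S ∈ U from Filter.univ_mem' hf)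
  refine ⟨v, hv, ?_⟩
  have : {v} ∈ U.map f := by rw [h]; exact Set.mem_singleton v
  exact this

/-- If every factor of `x` is a factor of the image of a word in `L`, then `x` is the image of a
sequence with language in `L`. -/
theorem exists_desub [Finite B] {φ : B → List A} {L : Set (List B)}
    (hL : ∀ w ∈ L, ∀ u, u <:+: w → u ∈ L) {x : ℤ → A}
    (hx : ∀ t ∈ seqLanguage x, ∃ w ∈ L, t <:+: wordMap φ w) :
    ∃ y c, Desub φ x y c ∧ seqLanguage y ⊆ L ∧ c 0 ≤ 0 ∧ 0 < c 1 := by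
  obtain ⟨M, hM⟩ : ∃ M, ∀ b, (φ b).length ≤ M := by
    obtain ⟨M, hM⟩ := (Set.finite_range fun b => (φ b).length).bddAbove
    exact ⟨M, fun b => hM ⟨b, rfl⟩⟩
  choose y o ho ho' hyL hy using exists_local_desub hM hL hx
  -- A nonprincipal ultrafilter selects the limits of all letters and of the offset simultaneously.
  let U : Ultrafilter ℕ := Filter.hyperfilter ℕ
  have hU : ∀ I : ℕ, ∀ᶠ J in (U : Filter ℕ), I ≤ J := fun I =>
    Nat.hyperfilter_le_atTop (Filter.eventually_ge_atTop I)
  have hlim : ∀ i : ℤ, ∃ b, ∀ᶠ J in (U : Filter ℕ), y J i = b := by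
    intro i
    obtain ⟨v, -, hv⟩ := exists_eventually_eq_of_finite U Set.finite_univ (fun J => y J i)
      (fun _ => Set.mem_univ _)
    exact ⟨v, hv⟩
  choose z hz using hlim
  obtain ⟨o₀, -, ho₀⟩ := exists_eventually_eq_of_finite U (Set.finite_Icc _ _) o ho
  have hev : ∀ I : ℕ, ∃ J, I ≤ J ∧ o J = o₀ ∧ ∀ i : ℤ, -I ≤ i → i ≤ I → y J i = z i := by
    intro I
    have h₁ : ∀ᶠ J in (U : Filter ℕ), ∀ i ∈ Set.Icc (-(I : ℤ)) I, y J i = z i :=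
      (Filter.eventually_all_finite (Set.finite_Icc _ _)).2 fun i _ => hz i
    obtain ⟨J, h₂, h₃, h₄⟩ := ((hU I).and (ho₀.and h₁)).exists
    exact ⟨J, h₂, h₃, fun i h₅ h₆ => h₄ i ⟨h₅, h₆⟩⟩
  refine ⟨z, cutPos φ z o₀, ?_, ?_, ?_, ?_⟩
  · intro i
    refine ⟨cutPos_succ φ z o₀ i, ?_⟩
    obtain ⟨J, h₁, h₂, h₃⟩ := hev i.natAbs
    rw [Int.natCast_natAbs] at h₃
    have hle := abs_le.1 (le_refl |i|)
    have h₄ := hy J i (by rw [Int.abs_eq_natAbs]; omega)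
    rwa [h₂, cutPos_congr φ o₀ (z := z), h₃ i hle.1 hle.2] at h₄
    intro j h₅ h₆
    exact h₃ j h₅ h₆.le
  · rintro _ ⟨i, n, rfl⟩
    obtain ⟨J, h₁, h₂, h₃⟩ := hev (i.natAbs + n)
    have h₄ : block z i n = block (y J) i n := by
      apply List.ext_getElem (by simp)
      intro m h₅ h₆
      rw [length_block] at h₅
      simp only [getElem_block]
      exact (h₃ _ (by omega) (by omega)).symm
    rw [h₄]
    exact hL _ (hyL J) _ (infix_block (by omega) (by omega))
  · obtain ⟨J, h₁, h₂, h₃⟩ := hev 0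
    rw [cutPos_zero, ← h₂]
    exact (ho J).2
  · obtain ⟨J, h₁, h₂, h₃⟩ := hev 0
    have := cutPos_succ φ z o₀ 0
    rw [zero_add, cutPos_zero] at this
    rw [this, ← h₂, ← h₃ 0 (by simp) (by simp)]
    exact ho' J

end Desubstitution

/-! ### Powers of words and languages of the form `v^* z u^*` -/

section Powers

variable {A : Type*}

/-- The `k`-th power of a word. -/
def wordPow (w : List A) (k : ℕ) : List A :=
  (List.replicate k w).flatten

@[simp] theorem wordPow_zero (w : List A) : wordPow w 0 = [] := rfl

theorem wordPow_succ (w : List A) (k : ℕ) : wordPow w (k + 1) = w ++ wordPow w k := by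
  simp [wordPow, List.replicate_succ]

theorem wordPow_add (w : List A) (m n : ℕ) :
    wordPow w (m + n) = wordPow w m ++ wordPow w n := by
  rw [wordPow, List.replicate_add, List.flatten_append]
  rfl

theorem wordPow_succ' (w : List A) (k : ℕ) : wordPow w (k + 1) = wordPow w k ++ w := by
  rw [wordPow_add]; simp [wordPow]

@[simp] theorem wordPow_nil (k : ℕ) : wordPow ([] : List A) k = [] := by
  simp [wordPow]

@[simp] theorem length_wordPow (w : List A) (k : ℕ) : (wordPow w k).length = k * w.length := by
  simp [wordPow]

theorem wordMap_replicate_unit (w : List A) (k : ℕ) :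
    wordMap (fun _ : Unit => w) (List.replicate k ()) = wordPow w k := by
  induction k with
  | zero => rfl
  | succ k ih => rw [List.replicate_succ, wordMap_cons, ih, wordPow_succ]

/-- The factors of the words `v^k z u^k`. -/
def pumpLanguage (v z u : List A) : Set (List A) :=
  {t | ∃ k, t <:+: wordPow v k ++ (z ++ wordPow u k)}

theorem pumpLanguage_of_infix {v z u t t' : List A} (ht : t ∈ pumpLanguage v z u)
    (h : t' <:+: t) : t' ∈ pumpLanguage v z u := by
  obtain ⟨k, hk⟩ := ht
  exact ⟨k, h.trans hk⟩

theorem exists_infix_central_block {x : ℤ → A} {t : List A} (ht : t ∈ seqLanguage x) :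
    ∃ N₀ : ℕ, ∀ N ≥ N₀, t <:+: block x (-(N : ℤ)) (N + N) := by
  obtain ⟨i, n, rfl⟩ := ht
  exact ⟨i.natAbs + n, fun N hN => infix_block (by omega) (by push_cast; omega)⟩

/-- The language of a sequence is irreducible for covers by finitely many factorial languages. -/
theorem exists_seqLanguage_subset {x : ℤ → A} {ι : Type*} [Finite ι] {E : ι → Set (List A)}
    (hE : ∀ i, ∀ t ∈ E i, ∀ t', t' <:+: t → t' ∈ E i) (hx : ∀ t ∈ seqLanguage x, ∃ i, t ∈ E i) :
    ∃ i, seqLanguage x ⊆ E i := by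
  -- One member of the cover contains arbitrarily large central blocks, and these contain every
  -- factor.
  have h₁ : ∀ N : ℕ, ∃ i, block x (-(N : ℤ)) (N + N) ∈ E i := fun N => hx _ ⟨_, _, rfl⟩
  choose i hi using h₁
  obtain ⟨v, -, hv⟩ := exists_eventually_eq_of_finite (Filter.hyperfilter ℕ) Set.finite_univ i
    (fun _ => Set.mem_univ _)
  refine ⟨v, fun t ht => ?_⟩
  obtain ⟨N₀, hN₀⟩ := exists_infix_central_block ht
  obtain ⟨N, h₂, h₃⟩ :=
    (hv.and (Nat.hyperfilter_le_atTop (Filter.eventually_ge_atTop N₀))).exists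
  rw [← h₂]
  exact hE _ _ (hi N) _ (hN₀ N h₃)

/-- If `w` is followed by at least as many letters as `q` has, it ends before `q` begins. -/
theorem infix_left_of_infix_append {w r a q : List A} (h : w ++ r <:+: a ++ q)
    (hr : q.length ≤ r.length) : w <:+: a := by
  obtain ⟨p, s, h⟩ := h
  have h₁ : p ++ w <+: a ++ q := ⟨r ++ s, by rw [← h]; simp⟩
  have h₂ : p ++ w <+: a := by
    refine List.prefix_of_prefix_length_le h₁ (List.prefix_append _ _) ?_
    have := congrArg List.length h
    simp only [List.length_append] at this ⊢
    omega
  exact (List.suffix_append p w).isInfix.trans h₂.isInfix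

theorem infix_right_of_infix_append {w r a q : List A} (h : r ++ w <:+: q ++ a)
    (hr : q.length ≤ r.length) : w <:+: a := by
  rw [← List.reverse_infix] at h ⊢
  rw [List.reverse_append, List.reverse_append] at h
  exact infix_left_of_infix_append h (by simpa using hr)

/-- A factor meeting both sides of `t` would contain `t`. -/
theorem infix_or_infix_of_not_infix {w a t b : List A} (h : w <:+: a ++ t ++ b)
    (ht : ¬ t <:+: w) : w <:+: a ++ t ∨ w <:+: t ++ b := by
  rw [List.infix_append_iff] at h
  rcases h with h | h | ⟨w₁, w₂, rfl, h₁, h₂⟩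
  · exact Or.inl h
  · exact Or.inr (h.trans (List.suffix_append _ _).isInfix)
  · right
    rcases List.suffix_or_suffix_of_suffix h₁ (List.suffix_append a t) with h | h
    · obtain ⟨p, rfl⟩ := h
      obtain ⟨q, rfl⟩ := h₂
      exact ⟨p, q, by simp⟩
    · exact absurd (h.isInfix.trans (List.prefix_append _ _).isInfix) ht

/-- A factor of a power of `v` loses at most `v.length` letters at each end, so one of length `(k +
2) * v.length + 1` contains `v^k`. The extra letter makes the count strict, also when `v` is empty.
-/
theorem seqLanguage_eq_of_subset_powers {x : ℤ → A} {v : List A}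
    (h : seqLanguage x ⊆ {t | ∃ k, t <:+: wordPow v k}) :
    seqLanguage x = {t | ∃ k, t <:+: wordPow v k} := by
  refine h.antisymm ?_
  rintro t ⟨k, hk⟩
  obtain ⟨j, hj⟩ := h ⟨0, (k + 2) * v.length + 1, rfl⟩
  rw [← wordMap_replicate_unit] at hj
  obtain ⟨p, w, q, -, h₂, hp, hq⟩ := exists_infix_wordMap (fun _ => le_rfl) hj
  have hw : w = List.replicate w.length () := List.eq_replicate_iff.2 ⟨rfl, fun _ _ => rfl⟩
  rw [hw, wordMap_replicate_unit] at h₂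
  have hlen := congrArg List.length h₂
  simp only [length_block, List.length_append, length_wordPow] at hlen
  have hkw : k ≤ w.length := by
    by_contra hlt
    have : w.length * v.length ≤ k * v.length := Nat.mul_le_mul_right _ (by omega)
    rw [add_mul] at hlen
    omega
  obtain ⟨d, hd⟩ := Nat.exists_eq_add_of_le hkw
  refine mem_seqLanguage_of_infix ⟨0, (k + 2) * v.length + 1, rfl⟩ (hk.trans ?_)
  rw [h₂, hd, wordPow_add]
  exact ⟨p, wordPow v d ++ q, by simp⟩

theorem exists_extension {x : ℤ → A} {w : List A} (hw : w ∈ seqLanguage x) (n : ℕ) :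
    (∃ r, r.length = n ∧ w ++ r ∈ seqLanguage x) ∧
      ∃ r, r.length = n ∧ r ++ w ∈ seqLanguage x := by
  obtain ⟨i, m, rfl⟩ := hw
  refine ⟨⟨block x (i + m) n, by simp, i, m + n, (block_add ..).symm⟩,
    ⟨block x (i - n) n, by simp, i - n, n + m, ?_⟩⟩
  rw [block_add, sub_add_cancel]

/-- A two-sided sequence whose factors are factors of words `v^k z u^k` is one of three kinds. -/
theorem seqLanguage_eq_pumpLanguage {x : ℤ → A} {v z u : List A}
    (h : seqLanguage x ⊆ pumpLanguage v z u) :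
    seqLanguage x = pumpLanguage v z u ∨ seqLanguage x = {t | ∃ k, t <:+: wordPow v k} ∨
      seqLanguage x = {t | ∃ k, t <:+: wordPow u k} := by
  by_cases hall : ∀ k, wordPow v k ++ (z ++ wordPow u k) ∈ seqLanguage x
  · left
    refine h.antisymm ?_
    rintro t ⟨k, hk⟩
    exact mem_seqLanguage_of_infix (hall k) hk
  right
  push Not at hall
  obtain ⟨k₀, hk₀⟩ := hall
  -- No factor of `x` contains `v^k₀ z u^k₀`, so each one misses what lies beyond that word on one
  -- side; irreducibility makes the side the same for all factors.
  let E : Bool → Set (List A) := fun b =>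
    if b then {t | ∃ k, t <:+: wordPow v k ++ (z ++ wordPow u k₀)}
    else {t | ∃ k, t <:+: wordPow v k₀ ++ z ++ wordPow u k}
  obtain ⟨b, hb⟩ : ∃ b, seqLanguage x ⊆ E b := by
    refine exists_seqLanguage_subset ?_ ?_
    · rintro (_ | _) t ⟨k, hk⟩ t' ht' <;> exact ⟨k, ht'.trans hk⟩
    · intro t ht
      obtain ⟨k, hk⟩ := h ht
      have hnot : ¬ wordPow v k₀ ++ (z ++ wordPow u k₀) <:+: t := fun hi =>
        hk₀ (mem_seqLanguage_of_infix ht hi)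
      -- Powers of one word commute, so the missing word can be placed in the middle of a longer
      -- pumped word.
      have hk' : t <:+: wordPow v k ++ (wordPow v k₀ ++ (z ++ wordPow u k₀)) ++ wordPow u k := by
        refine hk.trans ?_
        have h₁ : wordPow v k ++ (wordPow v k₀ ++ (z ++ wordPow u k₀)) ++ wordPow u k =
            wordPow v k₀ ++ ((wordPow v k ++ (z ++ wordPow u k)) ++ wordPow u k₀) := by
          have e₁ : wordPow v k ++ wordPow v k₀ = wordPow v k₀ ++ wordPow v k := by
            rw [← wordPow_add, ← wordPow_add, add_comm]
          have e₂ : wordPow u k₀ ++ wordPow u k = wordPow u k ++ wordPow u k₀ := by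
            rw [← wordPow_add, ← wordPow_add, add_comm]
          simp only [List.append_assoc]
          rw [e₂, ← List.append_assoc, e₁, List.append_assoc]
        rw [h₁]
        exact ⟨wordPow v k₀, wordPow u k₀, by simp⟩
      rcases infix_or_infix_of_not_infix hk' hnot with h₁ | h₁
      · refine ⟨true, k + k₀, ?_⟩
        rw [wordPow_add]
        simpa using h₁
      · refine ⟨false, k₀ + k, ?_⟩
        rw [wordPow_add]
        simpa using h₁
  cases b with
  | true =>
    left
    refine seqLanguage_eq_of_subset_powers fun t ht => ?_
    -- Extending `t` by the length of the bounded tail pushes `t` itself into the pure power of `v`.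
    obtain ⟨⟨r, hr, hr'⟩, -⟩ := exists_extension ht (z ++ wordPow u k₀).length
    obtain ⟨k, hk⟩ := hb hr'
    exact ⟨k, infix_left_of_infix_append hk hr.ge⟩
  | false =>
    right
    refine seqLanguage_eq_of_subset_powers fun t ht => ?_
    obtain ⟨-, ⟨r, hr, hr'⟩⟩ := exists_extension ht (wordPow v k₀ ++ z).length
    obtain ⟨k, hk⟩ := hb hr'
    exact ⟨k, infix_right_of_infix_append hk hr.ge⟩

end Powers

/-! ### Runs of fixed letters -/

section Gaps

variable {A : Type*}

/-- The first letter violating `P` is unique, which fixes the decomposition. -/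
theorem append_cons_inj_of_forall {P : A → Prop} {p q r s : List A} {a b : A}
    (h : p ++ a :: r = q ++ b :: s) (hp : ∀ c ∈ p, P c) (hq : ∀ c ∈ q, P c) (ha : ¬ P a)
    (hb : ¬ P b) : p = q ∧ a = b ∧ r = s := by
  induction p generalizing q with
  | nil =>
    cases q with
    | nil => simpa using h
    | cons c q =>
      simp only [List.nil_append, List.cons_append, List.cons.injEq] at h
      exact absurd (hq c (by simp)) (h.1 ▸ ha)
  | cons d p ih =>
    cases q with
    | nil =>
      simp only [List.nil_append, List.cons_append, List.cons.injEq] at h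
      exact absurd (hp d (by simp)) (h.1 ▸ hb)
    | cons c q =>
      simp only [List.cons_append, List.cons.injEq] at h
      obtain ⟨h₁, h₂, h₃⟩ := ih h.2 (fun c hc => hp c (by simp [hc]))
        (fun c hc => hq c (by simp [hc]))
      exact ⟨by rw [h.1, h₁], h₂, h₃⟩

theorem append_cons_inj_of_forall' {P : A → Prop} {p q r s : List A} {a b : A}
    (h : r ++ a :: p = s ++ b :: q) (hp : ∀ c ∈ p, P c) (hq : ∀ c ∈ q, P c) (ha : ¬ P a)
    (hb : ¬ P b) : p = q ∧ a = b ∧ r = s := by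
  have h' := congrArg List.reverse h
  simp only [List.reverse_append, List.reverse_cons, List.append_assoc, List.singleton_append]
    at h'
  obtain ⟨h₁, h₂, h₃⟩ := append_cons_inj_of_forall (P := P) h' (by simpa using hp)
    (by simpa using hq) ha hb
  exact ⟨List.reverse_injective h₁, h₂, List.reverse_injective h₃⟩

theorem exists_first_of_exists {P : A → Prop} {w : List A} (h : ∃ a ∈ w, ¬ P a) :
    ∃ t a r, w = t ++ a :: r ∧ (∀ c ∈ t, P c) ∧ ¬ P a := by
  induction w with
  | nil => simp at h
  | cons b w ih =>
    by_cases hb : P b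
    · obtain ⟨t, a, r, rfl, h₁, h₂⟩ := ih (by
        obtain ⟨a, ha, ha'⟩ := h
        rcases List.mem_cons.1 ha with rfl | ha
        · exact absurd hb ha'
        · exact ⟨a, ha, ha'⟩)
      exact ⟨b :: t, a, r, rfl, by simpa using ⟨hb, h₁⟩, h₂⟩
    · exact ⟨[], b, w, rfl, by simp, hb⟩

theorem exists_last_of_exists {P : A → Prop} {w : List A} (h : ∃ a ∈ w, ¬ P a) :
    ∃ t a r, w = r ++ a :: t ∧ (∀ c ∈ t, P c) ∧ ¬ P a := by
  obtain ⟨t, a, r, h₁, h₂, h₃⟩ := exists_first_of_exists (w := w.reverse) (by simpa using h)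
  refine ⟨t.reverse, a, r.reverse, ?_, by simpa using h₂, h₃⟩
  rw [← List.reverse_reverse w, h₁]
  simp

/-- Letters fixed by a morphism. -/
def IsFixed (s : A → List A) (a : A) : Prop := s a = [a]

/-- A morphism in which every letter that is not fixed has an image `u g (f g) ⋯ (l g) v g` with
`u g`, `v g` words over fixed letters and `f g`, `l g` letters that are not fixed, where `f` and
`l` are idempotent and recurrent letters recur at once. The letter `e` is a seed: its image begins
and ends with `e`. -/
structure IsSplit (s : A → List A) (e : A) (f l : A → A) (u v : A → List A) : Prop where
  first : ∀ g, ¬ IsFixed s g → (∀ c ∈ u g, IsFixed s c) ∧ ∃ r, s g = u g ++ f g :: r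
  first_moving : ∀ g, ¬ IsFixed s g → ¬ IsFixed s (f g)
  first_idem : ∀ g, f (f g) = f g
  last : ∀ g, ¬ IsFixed s g → (∀ c ∈ v g, IsFixed s c) ∧ ∃ r, s g = r ++ l g :: v g
  last_moving : ∀ g, ¬ IsFixed s g → ¬ IsFixed s (l g)
  last_idem : ∀ g, l (l g) = l g
  seed : ∃ m, s e = e :: (m ++ [e])
  recurrent : ∀ g n, g ∈ (wordMap s)^[n + 1] [g] → g ∈ s g

variable {s : A → List A} {e : A} {f l : A → A} {u v : A → List A}

namespace IsSplit

theorem ne_nil (H : IsSplit s e f l u v) (a : A) : s a ≠ [] := by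
  by_cases h : IsFixed s a
  · rw [h]; simp
  · obtain ⟨-, r, hr⟩ := H.first a h
    rw [hr]; simp

theorem not_isFixed_seed (H : IsSplit s e f l u v) : ¬ IsFixed s e := by
  obtain ⟨m, hm⟩ := H.seed
  intro h
  rw [IsFixed, hm] at h
  simp at h

theorem exists_iterate_seed (H : IsSplit s e f l u v) (n : ℕ) :
    ∃ m, (wordMap s)^[n + 1] [e] = e :: (m ++ [e]) := by
  obtain ⟨m, hm⟩ := H.seed
  induction n with
  | zero => exact ⟨m, by simpa using hm⟩
  | succ n ih =>
    obtain ⟨m', hm'⟩ := ih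
    rw [Function.iterate_succ_apply', hm']
    exact ⟨m ++ e :: (wordMap s m' ++ (e :: m)), by simp [hm]⟩

/-- Fixed letters are copied, so the first moving letter of `s(w)` comes from the first moving
letter `h'` of `w`, which also contributes `u h'` in front of it. -/
theorem exists_prefix_of_prefix (H : IsSplit s e f l u v) {w t : List A} {h : A}
    (ht : ∀ c ∈ t, IsFixed s c) (hh : ¬ IsFixed s h) (hp : t ++ [h] <+: wordMap s w) :
    ∃ t' h', t' ++ [h'] <+: w ∧ (∀ c ∈ t', IsFixed s c) ∧ ¬ IsFixed s h' ∧ t = t' ++ u h' ∧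
      h = f h' := by
  induction w generalizing t with
  | nil => simp at hp
  | cons a w ih =>
    rw [wordMap_cons] at hp
    by_cases ha : IsFixed s a
    · rw [show s a = [a] from ha] at hp
      cases t with
      | nil =>
        simp only [List.nil_append, List.singleton_append, List.cons_prefix_cons] at hp
        exact absurd ha (hp.1 ▸ hh)
      | cons b t =>
        simp only [List.cons_append, List.cons_prefix_cons, List.nil_append] at hp
        obtain ⟨rfl, hp⟩ := hp
        obtain ⟨t', h', h₁, h₂, h₃, rfl, h₅⟩ := ih (fun c hc => ht c (by simp [hc])) hp
        exact ⟨b :: t', h', by simpa using h₁, by simpa using ⟨ha, h₂⟩, h₃, by simp, h₅⟩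
    · obtain ⟨hu, r, hr⟩ := H.first a ha
      obtain ⟨q, hq⟩ := hp
      rw [hr] at hq
      simp only [List.append_assoc, List.cons_append] at hq
      obtain ⟨h₁, h₂, -⟩ := append_cons_inj_of_forall hq ht hu hh (H.first_moving a ha)
      exact ⟨[], a, by simp, by simp, ha, by simpa using h₁, h₂⟩

/-- A run between two moving letters is either born inside the image of one letter or inherited from
a run of `w`. An inherited run gains the fixed suffix of its left border's image and the fixed
prefix of its right border's image. -/
theorem exists_gap_of_gap (H : IsSplit s e f l u v) {w t : List A} {g h : A}
    (ht : ∀ c ∈ t, IsFixed s c) (hg : ¬ IsFixed s g) (hh : ¬ IsFixed s h)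
    (hi : g :: (t ++ [h]) <:+: wordMap s w) :
    (∃ a, g :: (t ++ [h]) <:+: s a) ∨ ∃ g' t' h', g' :: (t' ++ [h']) <:+: w ∧
      (∀ c ∈ t', IsFixed s c) ∧ ¬ IsFixed s g' ∧ ¬ IsFixed s h' ∧ g = l g' ∧ h = f h' ∧
      t = v g' ++ (t' ++ u h') := by
  induction w with
  | nil => simp at hi
  | cons a w ih =>
    rw [wordMap_cons, List.infix_append_iff] at hi
    rcases hi with hi | hi | ⟨w₁, w₂, h₁, h₂, h₃⟩
    · exact Or.inl ⟨a, hi⟩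
    · rcases ih hi with h₁ | ⟨g', t', h', h₁, h₂⟩
      · exact Or.inl h₁
      · exact Or.inr ⟨g', t', h', h₁.trans (List.suffix_cons _ _).isInfix, h₂⟩
    · cases w₁ with
      | nil =>
        rw [List.nil_append] at h₁
        subst h₁
        rcases ih h₃.isInfix with h₁ | ⟨g', t', h', h₁, h₂⟩
        · exact Or.inl h₁
        · exact Or.inr ⟨g', t', h', h₁.trans (List.suffix_cons _ _).isInfix, h₂⟩
      | cons b t₁ =>
        rw [List.cons_append, List.cons.injEq] at h₁
        obtain ⟨rfl, h₁⟩ := h₁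
        rcases List.eq_nil_or_concat w₂ with rfl | ⟨t₂, h₂', rfl⟩
        · left
          rw [List.append_nil] at h₁
          subst h₁
          exact ⟨a, h₂.isInfix⟩
        · rw [List.concat_eq_append, ← List.append_assoc] at h₁
          obtain ⟨rfl, h₄⟩ := List.append_inj' h₁ rfl
          obtain rfl : h = h₂' := by simpa using h₄
          right
          have ha : ¬ IsFixed s a := by
            intro ha
            rw [show s a = [a] from ha] at h₂
            have : g ∈ [a] := h₂.subset (by simp)
            rw [List.mem_singleton] at this
            exact hg (this ▸ ha)
          obtain ⟨hv, r, hr⟩ := H.last a ha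
          obtain ⟨q, hq⟩ := h₂
          rw [hr] at hq
          obtain ⟨h₅, h₆, -⟩ := append_cons_inj_of_forall' hq
            (fun c hc => ht c (by simp [hc])) hv hg (H.last_moving a ha)
          rw [List.concat_eq_append] at h₃
          obtain ⟨t', h', h₇, h₈, h₉, rfl, rfl⟩ := H.exists_prefix_of_prefix
            (fun c hc => ht c (by simp [hc])) hh h₃
          refine ⟨a, t', h', ?_, h₈, ha, h₉, h₆, rfl, by rw [h₅]⟩
          obtain ⟨q, hq⟩ := h₇
          exact ⟨[], q, by simp [← hq]⟩

end IsSplit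

/-- The central words of the runs of fixed letters in the words `s^n e`. -/
def gapCenters (s : A → List A) (u v : A → List A) : Set (List A) :=
  {z | ∃ a, z <:+: s a} ∪
    Set.range fun p : A × A × {z // ∃ a, z <:+: s a} => v p.1 ++ (p.2.2.1 ++ u p.2.1)

theorem finite_infixes (w : List A) : {z | z <:+: w}.Finite :=
  (List.finite_toSet w.sublists).subset fun _ hz => List.mem_sublists.2 hz.sublist

theorem finite_gapCenters [Finite A] (s : A → List A) (u v : A → List A) :
    (gapCenters s u v).Finite := by
  have h : {z | ∃ a, z <:+: s a}.Finite := by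
    have : {z | ∃ a, z <:+: s a} = ⋃ a, {z | z <:+: s a} := by ext; simp
    rw [this]
    exact Set.finite_iUnion fun a => finite_infixes (s a)
  have : Finite {z // ∃ a, z <:+: s a} := h
  exact h.union (Set.finite_range _)

namespace IsSplit

/-- After one inheritance the border letters lie in the ranges of `l` and `f`. By idempotence they
no longer change, so each later step adds the same two words. -/
theorem exists_gap_eq (H : IsSplit s e f l u v) {n : ℕ} {t : List A} {g h : A}
    (ht : ∀ c ∈ t, IsFixed s c) (hg : ¬ IsFixed s g) (hh : ¬ IsFixed s h)
    (hi : g :: (t ++ [h]) <:+: (wordMap s)^[n] [e]) :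
    ∃ z ∈ gapCenters s u v, ∃ k, t = wordPow (v g) k ++ (z ++ wordPow (u h) k) := by
  -- The first inheritance may use other borders `g₀`, `h₀` than the later ones; their contribution
  -- is absorbed into the centre.
  suffices h : ∃ g₀ z₀ h₀, (∃ a, z₀ <:+: s a) ∧ ((g = g₀ ∧ t = z₀ ∧ h = h₀) ∨
      ∃ k, g = l g₀ ∧ h = f h₀ ∧
        t = wordPow (v g) k ++ ((v g₀ ++ (z₀ ++ u h₀)) ++ wordPow (u h) k)) by
    obtain ⟨g₀, z₀, h₀, hz, ⟨rfl, rfl, rfl⟩ | ⟨k, rfl, rfl, h₁⟩⟩ := h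
    · exact ⟨t, Or.inl hz, 0, by simp⟩
    · exact ⟨_, Or.inr ⟨(g₀, h₀, ⟨z₀, hz⟩), rfl⟩, k, h₁⟩
  induction n generalizing g t h with
  | zero =>
    have := hi.length_le
    simp at this
  | succ n ih =>
    rw [Function.iterate_succ_apply'] at hi
    rcases H.exists_gap_of_gap ht hg hh hi with ⟨a, ha⟩ | ⟨g', t', h', h₁, h₂, h₃, h₄, rfl, rfl, rfl⟩
    · refine ⟨g, t, h, ⟨a, List.IsInfix.trans ⟨[g], [h], by simp⟩ ha⟩, Or.inl ⟨rfl, rfl, rfl⟩⟩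
    · obtain ⟨g₀, z₀, h₀, hz, ⟨rfl, rfl, rfl⟩ | ⟨k, rfl, rfl, h₅⟩⟩ := ih h₂ h₃ h₄ h₁
      · exact ⟨g', t', h', hz, Or.inr ⟨0, rfl, rfl, by simp⟩⟩
      · refine ⟨g₀, z₀, h₀, hz, Or.inr ⟨k + 1, H.last_idem _, H.first_idem _, ?_⟩⟩
        rw [H.last_idem, H.first_idem, h₅, wordPow_succ, wordPow_succ']
        simp

theorem infix_succ_of_infix (H : IsSplit s e f l u v) {m n : ℕ} (hmn : m ≤ n) {t : List A}
    (ht : t <:+: (wordMap s)^[m] [e]) : t <:+: (wordMap s)^[n] [e] := by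
  refine ht.trans (iterate_wordMap_infix_of_le ?_ hmn)
  obtain ⟨m, hm⟩ := H.seed
  exact ⟨[], m ++ [e], by simp [hm]⟩

/-- The iterates of the seed end with the moving letter `e`, so a factor can be prolonged up to a
moving letter unless it already ends at that final `e`. -/
theorem exists_right_gap (H : IsSplit s e f l u v) {t : List A}
    (hi : t ∈ orbitLanguage s [e]) : ∃ t' h, (∀ c ∈ t', IsFixed s c) ∧ ¬ IsFixed s h ∧
      (t ++ (t' ++ [h]) ∈ orbitLanguage s [e] ∨ ∃ p, t = p ++ [e]) := by
  obtain ⟨n, hn⟩ := hi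
  obtain ⟨p, q, hpq⟩ := H.infix_succ_of_infix (Nat.le_succ n) hn
  obtain ⟨m, hm⟩ := H.exists_iterate_seed n
  have hpq' := hpq
  rw [hm] at hpq'
  rcases List.eq_nil_or_concat q with rfl | ⟨q, b, rfl⟩
  · rcases List.eq_nil_or_concat t with rfl | ⟨t, b, rfl⟩
    · exact ⟨[], e, by simp, H.not_isFixed_seed, Or.inl ⟨0, by simp⟩⟩
    · refine ⟨[], e, by simp, H.not_isFixed_seed, Or.inr ⟨t, ?_⟩⟩
      rw [List.concat_eq_append, List.append_nil, ← List.append_assoc, ← List.cons_append] at hpq'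
      have := (List.append_inj' hpq' rfl).2
      rw [List.concat_eq_append, this]
  · rw [List.concat_eq_append, ← List.append_assoc, ← List.cons_append] at hpq'
    have hb := (List.append_inj' hpq' rfl).2
    obtain ⟨t', a, r, h₁, h₂, h₃⟩ := exists_first_of_exists (P := IsFixed s)
      (w := q.concat b) ⟨e, by simp [List.concat_eq_append, hb], H.not_isFixed_seed⟩
    refine ⟨t', a, h₂, h₃, Or.inl ⟨n + 1, p, r, ?_⟩⟩
    rw [← hpq, h₁]
    simp

/-- Words over fixed letters in the language have the form of factors of `v^k z u^k`. -/
theorem mem_pumpLanguage (H : IsSplit s e f l u v) {t : List A} (ht : ∀ c ∈ t, IsFixed s c)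
    (hi : t ∈ orbitLanguage s [e]) :
    ∃ g h, ∃ z ∈ gapCenters s u v, t ∈ pumpLanguage (v g) z (u h) := by
  rcases List.eq_nil_or_concat t with rfl | ⟨t₁, a, rfl⟩
  · exact ⟨e, e, [], Or.inl ⟨e, by simp⟩, 0, by simp⟩
  rw [List.concat_eq_append] at *
  obtain ⟨n, hn⟩ := hi
  obtain ⟨p, q, hpq⟩ := H.infix_succ_of_infix (Nat.le_succ n) hn
  obtain ⟨m, hm⟩ := H.exists_iterate_seed n
  -- The iterate starts with the moving letter `e`, which cannot belong to `t`.
  have hp : ∃ a ∈ p, ¬ IsFixed s a := by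
    cases p with
    | nil =>
      exfalso
      rw [hm] at hpq
      refine H.not_isFixed_seed (ht e ?_)
      cases t₁ with
      | nil => simp at hpq ⊢; exact hpq.1.symm
      | cons b t => simp at hpq ⊢; exact Or.inl hpq.1.symm
    | cons b p =>
      rw [hm] at hpq
      refine ⟨e, ?_, H.not_isFixed_seed⟩
      simp only [List.cons_append, List.cons.injEq] at hpq
      simp [hpq.1]
  obtain ⟨p', g, r, rfl, hp', hg⟩ := exists_last_of_exists hp
  have hmem : g :: (p' ++ (t₁ ++ [a])) ∈ orbitLanguage s [e] :=
    ⟨n + 1, r, q, by rw [← hpq]; simp⟩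
  obtain ⟨t', h, h₁, h₂, ⟨n', h₃⟩ | ⟨r', h₃⟩⟩ := H.exists_right_gap hmem
  · have h₄ : g :: ((p' ++ (t₁ ++ [a]) ++ t') ++ [h]) <:+: (wordMap s)^[n'] [e] := by
      simpa using h₃
    obtain ⟨z, hz, k, hk⟩ := H.exists_gap_eq (by
      intro c hc
      rcases List.mem_append.1 hc with hc | hc
      · rcases List.mem_append.1 hc with hc | hc
        · exact hp' c hc
        · exact ht c hc
      · exact h₁ c hc) hg h₂ h₄
    exact ⟨g, h, z, hz, k, by rw [← hk]; exact ⟨p', t', by simp⟩⟩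
  -- Here the last letter of `t`, which is fixed, would be `e`.
  · exfalso
    have h₄ : (g :: (p' ++ t₁)) ++ [a] = r' ++ [e] := by simpa using h₃
    have h₅ := (List.append_inj' h₄ rfl).2
    simp only [List.cons.injEq, and_true] at h₅
    exact H.not_isFixed_seed (ht e (by simp [h₅]))

/-- Sequences over fixed letters have one of finitely many languages. -/
theorem finite_seqLanguage_of_isFixed [Finite A] (H : IsSplit s e f l u v) :
    {L | ∃ x, seqLanguage x ⊆ orbitLanguage s [e] ∧ (∀ i, IsFixed s (x i)) ∧
      L = seqLanguage x}.Finite := by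
  have := (finite_gapCenters s u v).to_subtype
  let P := A × A × gapCenters s u v
  have hfin : (Set.range (fun p : P => pumpLanguage (v p.1) p.2.2.1 (u p.2.1)) ∪
    (Set.range (fun g : A => {t | ∃ k, t <:+: wordPow (v g) k}) ∪
      Set.range (fun g : A => {t | ∃ k, t <:+: wordPow (u g) k}))).Finite :=
    (Set.finite_range _).union ((Set.finite_range _).union (Set.finite_range _))
  refine hfin.subset ?_
  rintro L ⟨x, hx, hfix, rfl⟩
  obtain ⟨⟨g, h, z, hz⟩, hp⟩ : ∃ p : P, seqLanguage x ⊆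
      pumpLanguage (v p.1) p.2.2.1 (u p.2.1) := by
    refine exists_seqLanguage_subset (fun _ _ ht _ h => pumpLanguage_of_infix ht h) ?_
    intro t ht
    obtain ⟨g, h, z, hz, hmem⟩ := H.mem_pumpLanguage (t := t) (by
      obtain ⟨i, n, rfl⟩ := ht
      intro c hc
      obtain ⟨k, -, rfl⟩ := mem_block.1 hc
      exact hfix _) (hx ht)
    exact ⟨(g, h, ⟨z, hz⟩), hmem⟩
  rcases seqLanguage_eq_pumpLanguage hp with h₁ | h₁ | h₁
  · exact Or.inl ⟨_, h₁.symm⟩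
  · exact Or.inr (Or.inl ⟨g, h₁.symm⟩)
  · exact Or.inr (Or.inr ⟨h, h₁.symm⟩)

end IsSplit

end Gaps

/-! ### Chains of desubstitutions -/

section Chains

variable {A : Type*}

/-- A sequence of sequences, each the image of the next one under the morphism `s`, with cutting
points `c n` such that the image of the letter at the origin covers the origin. -/
structure IsChain (s : A → List A) (xs : ℕ → ℤ → A) (c : ℕ → ℤ → ℤ) : Prop where
  desub : ∀ n, Desub s (xs n) (xs (n + 1)) (c n)
  zero_nonpos : ∀ n, c n 0 ≤ 0
  one_pos : ∀ n, 0 < c n 1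

/-- The cutting points of the `n`-fold desubstitution. -/
def cutComp (c : ℕ → ℤ → ℤ) : ℕ → ℤ → ℤ
  | 0 => id
  | n + 1 => cutComp c n ∘ c n

variable {s : A → List A} {xs : ℕ → ℤ → A} {c : ℕ → ℤ → ℤ}

namespace IsChain

theorem occurs_iterate (hc : IsChain s xs c) (n : ℕ) {i : ℤ} {w : List A}
    (hw : Occurs (xs n) i w) : Occurs (xs 0) (cutComp c n i) ((wordMap s)^[n] w) ∧
      cutComp c n (i + w.length) = cutComp c n i + ((wordMap s)^[n] w).length := by
  induction n generalizing i w with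
  | zero => exact ⟨hw, rfl⟩
  | succ n ih =>
    obtain ⟨h₁, h₂⟩ := (hc.desub n).occurs hw
    obtain ⟨h₃, h₄⟩ := ih h₁
    refine ⟨h₃, ?_⟩
    simp only [cutComp, Function.comp_apply, h₂, h₄, Function.iterate_succ_apply]

theorem strictMono_cutComp (hc : IsChain s xs c) (hs : ∀ a, s a ≠ []) (n : ℕ) :
    StrictMono (cutComp c n) := by
  induction n with
  | zero => exact strictMono_id
  | succ n ih => exact ih.comp ((hc.desub n).strictMono hs)

/-- Each image covers the origin at its level, so the intervals from `cutComp c n 0` to `cutComp c n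
1` increase with `n`. -/
theorem monotone_cutComp_one (hc : IsChain s xs c) (hs : ∀ a, s a ≠ []) :
    Monotone fun n => cutComp c n 1 :=
  monotone_nat_of_le_succ fun n =>
    (hc.strictMono_cutComp hs n).monotone (show (1 : ℤ) ≤ c n 1 from hc.one_pos n)

theorem antitone_cutComp_zero (hc : IsChain s xs c) (hs : ∀ a, s a ≠ []) :
    Antitone fun n => cutComp c n 0 :=
  antitone_nat_of_succ_le fun n => (hc.strictMono_cutComp hs n).monotone (hc.zero_nonpos n)

theorem mem_letter (hc : IsChain s xs c) (n : ℕ) : xs n 0 ∈ s (xs (n + 1) 0) := by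
  obtain ⟨h₁, h₂⟩ := hc.desub n 0
  exact h₂.mem_of_lt (hc.zero_nonpos n) (by rw [← h₁]; exact hc.one_pos n)

theorem mem_iterate (hc : IsChain s xs c) (n k : ℕ) :
    xs n 0 ∈ (wordMap s)^[k] [xs (n + k) 0] := by
  induction k with
  | zero => simp
  | succ k ih =>
    have h : [xs (n + k) 0] <:+: wordMap s [xs (n + (k + 1)) 0] := by
      rw [wordMap_singleton, List.singleton_infix_iff]
      exact hc.mem_letter (n + k)
    exact (iterate_wordMap_infix s k h).subset ih

theorem not_isFixed (hc : IsChain s xs c) (h0 : ¬ IsFixed s (xs 0 0)) (n : ℕ) :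
    ¬ IsFixed s (xs n 0) := by
  induction n with
  | zero => exact h0
  | succ n ih =>
    intro h
    have := hc.mem_letter n
    rw [show s (xs (n + 1) 0) = [xs (n + 1) 0] from h, List.mem_singleton] at this
    exact ih (this ▸ h)

end IsChain

variable {e : A} {f l : A → A} {u v : A → List A}

theorem Occurs.eq_of_forall {P : A → Prop} {x : ℤ → A} {i : ℤ} {p q r t : List A} {a b : A}
    (h₁ : Occurs x i (p ++ a :: r)) (h₂ : Occurs x i (q ++ b :: t)) (hp : ∀ c ∈ p, P c)
    (hq : ∀ c ∈ q, P c) (ha : ¬ P a) (hb : ¬ P b) : p = q ∧ a = b := by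
  rcases le_total (p ++ a :: r).length (q ++ b :: t).length with h | h
  · obtain ⟨d, hd⟩ := h₂.prefix_of_le h₁ h
    rw [List.append_assoc, List.cons_append] at hd
    obtain ⟨h₃, h₄, -⟩ := append_cons_inj_of_forall hd hp hq ha hb
    exact ⟨h₃, h₄⟩
  · obtain ⟨d, hd⟩ := h₁.prefix_of_le h₂ h
    rw [List.append_assoc, List.cons_append] at hd
    obtain ⟨h₃, h₄, -⟩ := append_cons_inj_of_forall hd hq hp hb ha
    exact ⟨h₃.symm, h₄.symm⟩

/-- If the intervals covered by the images of the letters at the origin exhaust `ℤ`, the language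
is generated by a single letter. -/
theorem IsChain.exists_seqLanguage_eq [Finite A] (H : IsSplit s e f l u v)
    (hc : IsChain s xs c) (h₀ : ∀ B, ∃ n, cutComp c n 0 < B) (h₁ : ∀ B, ∃ n, B < cutComp c n 1) :
    ∃ g, seqLanguage (xs 0) = orbitLanguage s [g] := by
  obtain ⟨g, -, hg⟩ := exists_eventually_eq_of_finite (Filter.hyperfilter ℕ) Set.finite_univ
    (fun n => xs n 0) (fun _ => Set.mem_univ _)
  have hg' : ∀ N, ∃ n ≥ N, xs n 0 = g := fun N => by
    obtain ⟨n, h₂, h₃⟩ :=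
      (hg.and (Nat.hyperfilter_le_atTop (Filter.eventually_ge_atTop N))).exists
    exact ⟨n, h₃, h₂⟩
  -- Since `g` recurs along the chain, it lies in one of its own iterated images; `recurrent` brings
  -- this down to `s g`, so the iterates of `g` are nested.
  have hgg : [g] <:+: wordMap s [g] := by
    obtain ⟨n, -, hn⟩ := hg' 0
    obtain ⟨m, hm, hm'⟩ := hg' (n + 1)
    obtain ⟨k, rfl⟩ := Nat.exists_eq_add_of_le hm
    have := hc.mem_iterate n (k + 1)
    rw [hn, show n + (k + 1) = n + 1 + k by ring, hm'] at this
    rw [wordMap_singleton, List.singleton_infix_iff]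
    exact H.recurrent g k this
  have hocc : ∀ n, xs n 0 = g → Occurs (xs 0) (cutComp c n 0) ((wordMap s)^[n] [g]) ∧
      cutComp c n 1 = cutComp c n 0 + ((wordMap s)^[n] [g]).length := fun n hn => by
    have := hc.occurs_iterate n (i := 0) (w := [g]) (by simpa using hn)
    simpa using this
  refine ⟨g, Set.Subset.antisymm ?_ ?_⟩
  · rintro _ ⟨i, m, rfl⟩
    obtain ⟨n₀, hn₀⟩ := h₀ i
    obtain ⟨n₁, hn₁⟩ := h₁ (i + m)
    obtain ⟨n, hn, hng⟩ := hg' (max n₀ n₁)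
    obtain ⟨h₂, h₃⟩ := hocc n hng
    have h₄ := hc.antitone_cutComp_zero H.ne_nil (le_trans (le_max_left _ _) hn)
    have h₅ := hc.monotone_cutComp_one H.ne_nil (le_trans (le_max_right _ _) hn)
    simp only at h₄ h₅
    exact ⟨n, h₂.infix_of_le (occurs_block _ _ _) (by omega) (by rw [length_block]; omega)⟩
  · rintro t ⟨n, hn⟩
    obtain ⟨m, hm, hmg⟩ := hg' n
    exact mem_seqLanguage_of_infix (hocc m hmg).1.mem_seqLanguage
      (hn.trans (iterate_wordMap_infix_of_le hgg hm))

theorem exists_stable_of_bounded {F : ℕ → ℤ} (hF : Monotone F) {B : ℤ} (hB : ∀ n, F n ≤ B) :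
    ∃ N, ∀ n ≥ N, F n = F N := by
  obtain ⟨m, ⟨N, rfl⟩, hm⟩ := Int.exists_greatest_of_bdd (P := fun z => ∃ n, F n = z)
    ⟨B, by rintro z ⟨n, rfl⟩; exact hB n⟩ ⟨F 0, 0, rfl⟩
  exact ⟨N, fun n hn => le_antisymm (hm _ ⟨n, rfl⟩) (hF hn)⟩

/-- Data of a chain whose intervals are eventually stationary on the right. -/
theorem IsChain.exists_stationary (H : IsSplit s e f l u v) (hc : IsChain s xs c)
    (h0 : ¬ IsFixed s (xs 0 0)) {B : ℤ} (hB : ∀ n, cutComp c n 1 ≤ B) :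
    ∃ N g, ¬ IsFixed s g ∧ v g = [] ∧ (∃ r, r ≠ [] ∧ s g = r ++ [g]) ∧
      ∀ n ≥ N, xs n 0 = g ∧ c n 1 = 1 ∧ cutComp c n 1 = cutComp c N 1 := by
  obtain ⟨N, hN⟩ := exists_stable_of_bounded (hc.monotone_cutComp_one H.ne_nil) hB
  -- Stationarity says that the injective map `cutComp c n` takes equal values at `c n 1` and `1`.
  have hc1 : ∀ n ≥ N, c n 1 = 1 := fun n hn => by
    have h₁ : cutComp c n (c n 1) = cutComp c n 1 := by
      have := hN (n + 1) (by omega)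
      simp only [cutComp, Function.comp_apply] at this
      rw [this]
      exact (hN n hn).symm
    exact (hc.strictMono_cutComp H.ne_nil n).injective h₁
  -- The image of `xs (n + 1) 0` ends at position `0`, so its last letter is the moving letter `xs n
  -- 0`; hence no fixed letters follow the last moving one.
  have hstep : ∀ n ≥ N, xs n 0 = l (xs (n + 1) 0) ∧ v (xs (n + 1) 0) = [] := by
    intro n hn
    obtain ⟨h₁, h₂⟩ := hc.desub n 0
    rw [zero_add, hc1 n hn] at h₁
    obtain ⟨hv, r, hr⟩ := H.last _ (hc.not_isFixed h0 (n + 1))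
    rw [hr, List.length_append, List.length_cons] at h₁
    rw [hr, occurs_append, occurs_cons] at h₂
    push_cast at h₁
    rcases List.eq_nil_or_concat (v (xs (n + 1) 0)) with h₃ | ⟨p, b, h₃⟩
    · rw [h₃] at h₁
      refine ⟨?_, h₃⟩
      rw [← h₂.2.1]
      congr 1
      simp at h₁
      omega
    · exfalso
      have h₄ : xs n 0 ∈ v (xs (n + 1) 0) :=
        h₂.2.2.mem_of_lt (by
          rw [h₃, List.concat_eq_append, List.length_append] at h₁
          simp at h₁
          omega) (by omega)
      exact hc.not_isFixed h0 n (hv _ h₄)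
  have hconst : ∀ n ≥ N, xs (n + 1) 0 = xs n 0 := fun n hn => by
    rw [(hstep n hn).1, (hstep (n + 1) (by omega)).1, H.last_idem]
  have hconst' : ∀ n ≥ N, xs n 0 = xs N 0 := fun n hn => by
    induction n, hn using Nat.le_induction with
    | base => rfl
    | succ n hn ih => rw [hconst n hn, ih]
  have hstepN := hstep N le_rfl
  rw [hconst N le_rfl] at hstepN
  refine ⟨N, xs N 0, hc.not_isFixed h0 N, hstepN.2, ?_, fun n hn =>
    ⟨hconst' n hn, hc1 n hn, hN n hn⟩⟩
  obtain ⟨-, r, hr⟩ := H.last _ (hc.not_isFixed h0 N)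
  rw [hstepN.2, ← hstepN.1] at hr
  refine ⟨r, ?_, hr⟩
  rintro rfl
  exact hc.not_isFixed h0 N hr

theorem le_length_iterate_of_suffix (hs : ∀ a, s a ≠ []) {g : A} {r : List A} (hr : r ≠ [])
    (hg : s g = r ++ [g]) (n : ℕ) : n ≤ ((wordMap s)^[n] [g]).length := by
  induction n with
  | zero => simp
  | succ n ih =>
    rw [Function.iterate_succ_apply, wordMap_singleton, hg, iterate_wordMap_append,
      List.length_append]
    have h₁ := length_le_length_iterate_wordMap hs n r
    have h₂ := List.length_pos_iff.2 hr
    omega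

theorem le_length_iterate_of_prefix (hs : ∀ a, s a ≠ []) {g : A} {r : List A} (hr : r ≠ [])
    (hg : s g = g :: r) (n : ℕ) : n ≤ ((wordMap s)^[n] [g]).length := by
  induction n with
  | zero => simp
  | succ n ih =>
    rw [Function.iterate_succ_apply, wordMap_singleton, hg, ← List.singleton_append,
      iterate_wordMap_append, List.length_append]
    have h₁ := length_le_length_iterate_wordMap hs n r
    have h₂ := List.length_pos_iff.2 hr
    omega

/-- The language generated by the words `g z w^i`. -/
def tailLanguage (s : A → List A) (g : A) (z w : List A) : Set (List A) :=
  {t | ∃ n i, t <:+: (wordMap s)^[n] (g :: (z ++ wordPow w i))}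

/-- The first moving letter `h` after `g` and the run `z` between them become constant along the
chain. The iterates of `g` grow to the left and those of `h` to the right, so the images of `g z h`
exhaust `ℤ`. -/
theorem IsChain.seqLanguage_eq_of_moving (H : IsSplit s e f l u v) (hc : IsChain s xs c)
    (hL : ∀ n, seqLanguage (xs n) ⊆ orbitLanguage s [e]) {N : ℕ} {g : A}
    (hg : ¬ IsFixed s g) (hv : v g = []) {r : List A} (hr : r ≠ []) (hsg : s g = r ++ [g])
    (hN : ∀ n ≥ N, xs n 0 = g ∧ c n 1 = 1 ∧ cutComp c n 1 = cutComp c N 1)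
    (hm : ∀ n ≥ N, ∃ i ≥ (1 : ℤ), ¬ IsFixed s (xs n i)) :
    ∃ h, ∃ z ∈ gapCenters s u v, seqLanguage (xs 0) = orbitLanguage s (g :: (z ++ [h])) := by
  -- For `n < N` the chosen values are placeholders.
  have hex : ∀ n, ∃ z h, N ≤ n → Occurs (xs n) 1 (z ++ [h]) ∧ (∀ c ∈ z, IsFixed s c) ∧
      ¬ IsFixed s h := by
    intro n
    by_cases hn : N ≤ n
    · obtain ⟨i, hi, hi'⟩ := hm n hn
      obtain ⟨z, h, t, h₁, h₂, h₃⟩ := exists_first_of_exists (P := IsFixed s)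
        (w := block (xs n) 1 i.toNat) ⟨xs n i, mem_block.2 ⟨(i - 1).toNat, by omega, by
          congr 1; omega⟩, hi'⟩
      have h₄ := occurs_block (xs n) 1 i.toNat
      rw [h₁] at h₄
      exact ⟨z, h, fun _ => ⟨h₄.of_prefix ⟨t, by simp⟩, h₂, h₃⟩⟩
    · exact ⟨[], g, fun h => absurd h hn⟩
  choose z h hzh using hex
  have hstep : ∀ n ≥ N, z n = z (n + 1) ++ u (h (n + 1)) ∧ h n = f (h (n + 1)) := by
    intro n hn
    obtain ⟨h₁, h₂, h₃⟩ := hzh n hn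
    obtain ⟨h₄, h₅, h₆⟩ := hzh (n + 1) (by omega)
    have h₇ := ((hc.desub n).occurs h₄).1
    obtain ⟨hu, r', hr'⟩ := H.first _ h₆
    rw [(hN n hn).2.1, wordMap_append, wordMap_of_fixed h₅, wordMap_singleton, hr',
      ← List.append_assoc] at h₇
    exact h₁.eq_of_forall h₇ h₂ (by
      intro c hc
      rcases List.mem_append.1 hc with hc | hc
      · exact h₅ c hc
      · exact hu c hc) h₃ (H.first_moving _ h₆)
  have hh : ∀ n ≥ N, h n = h N := fun n hn => by
    induction n, hn using Nat.le_induction with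
    | base => rfl
    | succ n hn ih => rw [← ih, (hstep n hn).2, (hstep (n + 1) (by omega)).2, H.first_idem]
  have hfh : f (h N) = h N := by
    rw [(hstep N le_rfl).2, H.first_idem]
  -- The run would shrink by the length of `u (h N)` at every level, so that word must be empty.
  have hlen : ∀ k, (z N).length = (z (N + k)).length + k * (u (h N)).length := by
    intro k
    induction k with
    | zero => simp
    | succ k ih =>
      rw [ih, (hstep (N + k) (by omega)).1, List.length_append, hh (N + k + 1) (by omega)]
      ring_nf
  have hu : u (h N) = [] := by
    by_contra hne
    have h₁ := hlen ((z N).length + 1)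
    have h₂ := List.length_pos_iff.2 hne
    have h₃ : ((z N).length + 1) * 1 ≤ ((z N).length + 1) * (u (h N)).length :=
      Nat.mul_le_mul_left _ h₂
    omega
  have hz : ∀ n ≥ N, z n = z N := fun n hn => by
    induction n, hn using Nat.le_induction with
    | base => rfl
    | succ n hn ih =>
      rw [← ih, (hstep n hn).1, hh (n + 1) (by omega), hu, List.append_nil]
  obtain ⟨hocc, hzfix, hhm⟩ := hzh N le_rfl
  obtain ⟨-, r', hr'⟩ := H.first _ hhm
  rw [hu, hfh, List.nil_append] at hr'
  have hr'0 : r' ≠ [] := by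
    rintro rfl
    exact hhm hr'
  have hoccn : ∀ n ≥ N, Occurs (xs n) 0 (g :: (z N ++ [h N])) := fun n hn => by
    rw [occurs_cons, zero_add, ← hz n hn, ← hh n hn]
    exact ⟨(hN n hn).1, (hzh n hn).1⟩
  have hzc : z N ∈ gapCenters s u v := by
    obtain ⟨n, hn⟩ := hL N (hoccn N le_rfl).mem_seqLanguage
    obtain ⟨z', hz', k, hk⟩ := H.exists_gap_eq hzfix hg hhm hn
    rw [hv, hu, wordPow_nil, List.append_nil, List.nil_append] at hk
    rwa [hk]
  refine ⟨h N, z N, hzc, Set.Subset.antisymm ?_ ?_⟩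
  · rintro _ ⟨i, m, rfl⟩
    -- The `n`-th images of `g` and `h N` have length at least `n`, enough to cover the block on
    -- both sides of the stationary cut.
    let n : ℕ := N + ((cutComp c N 1 - i).toNat + (i + m - cutComp c N 1).toNat)
    have hn : N ≤ n := by omega
    have h₁ := (hc.occurs_iterate n (hoccn n hn)).1
    have h₂ := (hc.occurs_iterate n (i := 0) (w := [g]) (by simpa using (hN n hn).1)).2
    have h₃ := le_length_iterate_of_suffix H.ne_nil hr hsg n
    have h₄ := le_length_iterate_of_prefix H.ne_nil hr'0 hr' n
    rw [← List.singleton_append, iterate_wordMap_append, iterate_wordMap_append] at h₁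
    simp only [List.length_singleton, Nat.cast_one, zero_add] at h₂
    rw [(hN n hn).2.2] at h₂
    refine ⟨n, ?_⟩
    rw [← List.singleton_append, iterate_wordMap_append, iterate_wordMap_append]
    refine h₁.infix_of_le (occurs_block _ _ _) (by omega) ?_
    simp only [length_block, List.length_append]
    push_cast
    omega
  · rintro t ⟨n, hn⟩
    have h₁ : g :: (z N ++ [h N]) <:+: wordMap s (g :: (z N ++ [h N])) :=
      ⟨r, r', by simp [hsg, hr', wordMap_of_fixed hzfix]⟩
    have h₂ := (hc.occurs_iterate (max n N) (hoccn _ (le_max_right _ _))).1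
    exact mem_seqLanguage_of_infix h₂.mem_seqLanguage
      (hn.trans (iterate_wordMap_infix_of_le h₁ (le_max_left _ _)))

/-- A ray of fixed letters is unchanged along the chain. Being a run to the right of `g` with `v g`
empty, it has all its prefixes among the prefixes of words `z u^i`, for one `z` and one `u`. -/
theorem IsChain.seqLanguage_eq_of_fixed [Finite A] (H : IsSplit s e f l u v)
    (hc : IsChain s xs c)
    (hL : ∀ n, seqLanguage (xs n) ⊆ orbitLanguage s [e]) {N : ℕ} {g : A}
    (hg : ¬ IsFixed s g) (hv : v g = []) {r : List A} (hr : r ≠ []) (hsg : s g = r ++ [g])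
    (hN : ∀ n ≥ N, xs n 0 = g ∧ c n 1 = 1 ∧ cutComp c n 1 = cutComp c N 1)
    {M : ℕ} (hM : N ≤ M) (hm : ∀ i ≥ (1 : ℤ), IsFixed s (xs M i)) :
    ∃ h, ∃ z ∈ gapCenters s u v, seqLanguage (xs 0) = tailLanguage s g z (u h) := by
  have hfix : ∀ n ≥ M, ∀ k, block (xs n) 1 k = block (xs M) 1 k ∧
      ∀ c ∈ block (xs n) 1 k, IsFixed s c := by
    intro n hn
    induction n, hn using Nat.le_induction with
    | base =>
      refine fun k => ⟨rfl, fun c hc => ?_⟩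
      obtain ⟨j, -, rfl⟩ := mem_block.1 hc
      exact hm _ (by omega)
    | succ n hn ih =>
      -- A moving letter `b` in the next ray would put the moving letter `f b` into the current one.
      have h₁ : ∀ k, ∀ c ∈ block (xs (n + 1)) 1 k, IsFixed s c := by
        intro k b hb
        by_contra hbm
        have h₂ := ((hc.desub n).occurs (occurs_block (xs (n + 1)) 1 k)).1
        rw [(hN n (by omega)).2.1] at h₂
        obtain ⟨-, r', hr'⟩ := H.first b hbm
        have h₃ : f b ∈ wordMap s (block (xs (n + 1)) 1 k) :=
          mem_wordMap.2 ⟨b, hb, by rw [hr']; simp⟩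
        unfold Occurs at h₂
        rw [← h₂] at h₃
        exact H.first_moving b hbm ((ih _).2 _ h₃)
      refine fun k => ⟨?_, h₁ k⟩
      have h₂ := ((hc.desub n).occurs (occurs_block (xs (n + 1)) 1 k)).1
      rw [(hN n (by omega)).2.1, wordMap_of_fixed (h₁ k)] at h₂
      unfold Occurs at h₂
      rw [length_block] at h₂
      rw [← h₂, (ih k).1]
  have hoccn : ∀ n ≥ M, ∀ k, Occurs (xs n) 0 (g :: block (xs M) 1 k) := fun n hn k => by
    rw [occurs_cons, zero_add, ← (hfix n hn k).1]
    exact ⟨(hN n (by omega)).1, occurs_block _ _ _⟩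
  have := (finite_gapCenters s u v).to_subtype
  -- Length `k + 1` makes the block nonempty, so it ends in a fixed letter and the exceptional case
  -- of `exists_right_gap` is excluded.
  have hpre : ∀ k : ℕ, ∃ p : A × gapCenters s u v, ∃ i,
      block (xs M) 1 (k + 1) <+: p.2.1 ++ wordPow (u p.1) i := by
    intro k
    obtain ⟨t', h, h₁, h₂, ⟨n, h₃⟩ | ⟨p, h₃⟩⟩ := H.exists_right_gap
      (hL M (hoccn M le_rfl (k + 1)).mem_seqLanguage)
    · have h₄ : g :: ((block (xs M) 1 (k + 1) ++ t') ++ [h]) <:+: (wordMap s)^[n] [e] := by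
        simpa using h₃
      obtain ⟨z, hz, i, hi⟩ := H.exists_gap_eq (by
        intro c hc
        rcases List.mem_append.1 hc with hc | hc
        · exact (hfix M le_rfl _).2 c hc
        · exact h₁ c hc) hg h₂ h₄
      rw [hv, wordPow_nil, List.nil_append] at hi
      exact ⟨(h, ⟨z, hz⟩), i, t', hi⟩
    · exfalso
      rw [block_add, block_one, ← List.cons_append] at h₃
      have h₄ := (List.append_inj' h₃ rfl).2
      simp only [List.cons.injEq, and_true] at h₄
      exact H.not_isFixed_seed (h₄ ▸ hm _ (by omega))
  choose p hp using hpre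
  obtain ⟨⟨h, z, hz⟩, -, hpv⟩ := exists_eventually_eq_of_finite (Filter.hyperfilter ℕ)
    Set.finite_univ p (fun _ => Set.mem_univ _)
  have hpre' : ∀ k : ℕ, ∃ i, block (xs M) 1 k <+: z ++ wordPow (u h) i := by
    intro k
    obtain ⟨K, h₁, h₂⟩ :=
      (hpv.and (Nat.hyperfilter_le_atTop (Filter.eventually_ge_atTop k))).exists
    obtain ⟨i, hi⟩ := hp K
    rw [h₁] at hi
    refine ⟨i, List.IsPrefix.trans ?_ hi⟩
    obtain ⟨d, hd⟩ := Nat.exists_eq_add_of_le h₂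
    rw [hd, add_assoc, block_add]
    exact List.prefix_append _ _
  -- Both words are prefixes of a common `z u^(i + j)` and have equal length.
  have hpow : ∀ i, block (xs M) 1 (z ++ wordPow (u h) i).length = z ++ wordPow (u h) i := by
    intro i
    obtain ⟨j, hj⟩ := hpre' (z ++ wordPow (u h) i).length
    have h₁ : ∀ a b, z ++ wordPow (u h) a <+: z ++ wordPow (u h) (a + b) := fun a b => by
      rw [wordPow_add, ← List.append_assoc]
      exact List.prefix_append _ _
    have h₂ := hj.trans (h₁ j i)
    rw [add_comm] at h₂
    exact (List.prefix_of_prefix_length_le h₂ (h₁ i j) (by simp)).eq_of_length (by simp)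
  refine ⟨h, z, hz, Set.Subset.antisymm ?_ ?_⟩
  · rintro _ ⟨i, m, rfl⟩
    let n : ℕ := M + (cutComp c N 1 - i).toNat
    let k : ℕ := (i + m - cutComp c N 1).toNat
    have hn : M ≤ n := by omega
    have h₁ := (hc.occurs_iterate n (hoccn n hn k)).1
    have h₂ := (hc.occurs_iterate n (i := 0) (w := [g]) (by simpa using (hN n (by omega)).1)).2
    have h₃ := le_length_iterate_of_suffix H.ne_nil hr hsg n
    have h₄ := length_le_length_iterate_wordMap H.ne_nil n (block (xs M) 1 k)
    rw [length_block] at h₄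
    simp only [List.length_singleton, Nat.cast_one, zero_add] at h₂
    rw [(hN n (by omega)).2.2] at h₂
    obtain ⟨j, hj⟩ := hpre' k
    refine ⟨n, j, List.IsInfix.trans ?_ (iterate_wordMap_infix s n
      ((List.cons_prefix_cons.2 ⟨rfl, hj⟩).isInfix))⟩
    rw [← List.singleton_append, iterate_wordMap_append] at h₁ ⊢
    refine h₁.infix_of_le (occurs_block _ _ _) (by omega) ?_
    simp only [length_block, List.length_append]
    push_cast
    omega
  · rintro t ⟨n, i, hn⟩
    have hfix' : ∀ c ∈ z ++ wordPow (u h) i, IsFixed s c := by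
      rw [← hpow]
      exact (hfix M le_rfl _).2
    have h₁ : g :: (z ++ wordPow (u h) i) <:+: wordMap s (g :: (z ++ wordPow (u h) i)) :=
      ⟨r, [], by rw [wordMap_cons, wordMap_of_fixed hfix', hsg]; simp⟩
    have h₂ := hoccn (max n M) (le_max_right _ _) (z ++ wordPow (u h) i).length
    rw [hpow] at h₂
    exact mem_seqLanguage_of_infix (hc.occurs_iterate _ h₂).1.mem_seqLanguage
      (hn.trans (iterate_wordMap_infix_of_le h₁ (le_max_left _ _)))

/-- The languages of the sequences `x` with a chain of desubstitutions in the language of `e`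
whose intervals around the origin are bounded on the right. -/
def rightBoundedLanguages (s : A → List A) (e : A) : Set (Set (List A)) :=
  {L | ∃ xs c, IsChain s xs c ∧ (∀ n, seqLanguage (xs n) ⊆ orbitLanguage s [e]) ∧
    ¬ IsFixed s (xs 0 0) ∧ (∃ B, ∀ n, cutComp c n 1 ≤ B) ∧ L = seqLanguage (xs 0)}

theorem IsSplit.finite_rightBoundedLanguages [Finite A] (H : IsSplit s e f l u v) :
    (rightBoundedLanguages s e).Finite := by
  have := (finite_gapCenters s u v).to_subtype
  let P := A × A × gapCenters s u v
  have hfin : (Set.range (fun p : P => orbitLanguage s (p.1 :: (p.2.2.1 ++ [p.2.1]))) ∪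
      Set.range (fun p : P => tailLanguage s p.1 p.2.2.1 (u p.2.1))).Finite :=
    (Set.finite_range _).union (Set.finite_range _)
  refine hfin.subset ?_
  rintro L ⟨xs, c, hc, hL, h0, ⟨B, hB⟩, rfl⟩
  obtain ⟨N, g, hg, hv, ⟨r, hr, hsg⟩, hN⟩ := hc.exists_stationary H h0 hB
  by_cases hm : ∀ n ≥ N, ∃ i ≥ (1 : ℤ), ¬ IsFixed s (xs n i)
  · obtain ⟨h, z, hz, heq⟩ := hc.seqLanguage_eq_of_moving H hL hg hv hr hsg hN hm
    exact Or.inl ⟨(g, h, ⟨z, hz⟩), heq.symm⟩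
  · push Not at hm
    obtain ⟨M, hM, hm⟩ := hm
    obtain ⟨h, z, hz, heq⟩ := hc.seqLanguage_eq_of_fixed H hL hg hv hr hsg hN hM hm
    exact Or.inr ⟨(g, h, ⟨z, hz⟩), heq.symm⟩

end Chains

/-! ### Reversal -/

section Reversal

variable {A : Type*}

/-- The morphism `s` read from right to left. -/
def revMap (s : A → List A) (a : A) : List A := (s a).reverse

theorem wordMap_revMap (s : A → List A) (w : List A) :
    wordMap (revMap s) w.reverse = (wordMap s w).reverse := by
  induction w with
  | nil => rfl
  | cons a w ih => simp [ih, revMap]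

theorem iterate_wordMap_revMap (s : A → List A) (n : ℕ) (w : List A) :
    (wordMap (revMap s))^[n] w.reverse = ((wordMap s)^[n] w).reverse := by
  induction n generalizing w with
  | zero => rfl
  | succ n ih => rw [Function.iterate_succ_apply, wordMap_revMap, ih, Function.iterate_succ_apply]

theorem isFixed_revMap {s : A → List A} {a : A} : IsFixed (revMap s) a ↔ IsFixed s a := by
  unfold IsFixed revMap
  rw [List.reverse_eq_iff]
  rfl

theorem reverse_mem_orbitLanguage {s : A → List A} {e : A} {t : List A}
    (ht : t ∈ orbitLanguage s [e]) : t.reverse ∈ orbitLanguage (revMap s) [e] := by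
  obtain ⟨n, hn⟩ := ht
  refine ⟨n, ?_⟩
  have := iterate_wordMap_revMap s n [e]
  rw [List.reverse_singleton] at this
  rw [this]
  exact List.reverse_infix.2 hn

theorem Occurs.reverse {x : ℤ → A} {i : ℤ} {w : List A} (h : Occurs x i w) :
    Occurs (fun j => x (-j)) (1 - i - w.length) w.reverse := by
  induction w generalizing i with
  | nil => simp
  | cons a w ih =>
    rw [occurs_cons] at h
    rw [List.reverse_cons, occurs_append, occurs_singleton, List.length_reverse,
      List.length_cons, ← h.1]
    push_cast
    refine ⟨?_, by congr 1; ring⟩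
    convert ih h.2 using 1
    ring

theorem seqLanguage_neg (x : ℤ → A) :
    seqLanguage (fun j => x (-j)) = List.reverse '' seqLanguage x := by
  ext t
  rw [Set.mem_image]
  constructor
  · intro ht
    obtain ⟨i, hi⟩ := mem_seqLanguage.1 ht
    refine ⟨t.reverse, ?_, List.reverse_reverse t⟩
    have := hi.reverse.mem_seqLanguage
    simpa using this
  · rintro ⟨w, hw, rfl⟩
    obtain ⟨i, hi⟩ := mem_seqLanguage.1 hw
    exact hi.reverse.mem_seqLanguage

theorem IsSplit.reverse {s : A → List A} {e : A} {f l : A → A} {u v : A → List A}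
    (H : IsSplit s e f l u v) :
    IsSplit (revMap s) e l f (fun a => (v a).reverse) (fun a => (u a).reverse) where
  first g hg := by
    rw [isFixed_revMap] at hg
    obtain ⟨h₁, r, hr⟩ := H.last g hg
    exact ⟨fun c hc => isFixed_revMap.2 (h₁ c (List.mem_reverse.1 hc)), r.reverse, by
      simp [revMap, hr]⟩
  first_moving g hg := by
    rw [isFixed_revMap] at hg ⊢
    exact H.last_moving g hg
  first_idem := H.last_idem
  last g hg := by
    rw [isFixed_revMap] at hg
    obtain ⟨h₁, r, hr⟩ := H.first g hg
    exact ⟨fun c hc => isFixed_revMap.2 (h₁ c (List.mem_reverse.1 hc)), r.reverse, by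
      simp [revMap, hr]⟩
  last_moving g hg := by
    rw [isFixed_revMap] at hg ⊢
    exact H.first_moving g hg
  last_idem := H.first_idem
  seed := by
    obtain ⟨m, hm⟩ := H.seed
    exact ⟨m.reverse, by simp [revMap, hm]⟩
  recurrent g n hg := by
    have := iterate_wordMap_revMap s (n + 1) [g]
    rw [List.reverse_singleton] at this
    rw [this, List.mem_reverse] at hg
    exact List.mem_reverse.2 (H.recurrent g n hg)

/-- Under `j ↦ -j`, the image of the letter at `-i`, which ends just before `c n (1 - i)`, starts at
`1 - c n (1 - i)`. -/
theorem IsChain.reverse {s : A → List A} {xs : ℕ → ℤ → A} {c : ℕ → ℤ → ℤ}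
    (hc : IsChain s xs c) :
    IsChain (revMap s) (fun n j => xs n (-j)) (fun n i => 1 - c n (1 - i)) where
  desub n i := by
    obtain ⟨h₁, h₂⟩ := hc.desub n (-i)
    rw [show -i + 1 = 1 - i by ring] at h₁
    change 1 - c n (1 - (i + 1)) = 1 - c n (1 - i) + ((revMap s (xs (n + 1) (-i))).length : ℤ) ∧
      Occurs (fun j => xs n (-j)) (1 - c n (1 - i)) (revMap s (xs (n + 1) (-i)))
    rw [show 1 - (i + 1) = -i by ring, h₁]
    refine ⟨by simp only [revMap, List.length_reverse]; ring, ?_⟩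
    convert h₂.reverse using 1
    · ring
    · rfl
  zero_nonpos n := by
    have := hc.one_pos n
    simp only [sub_zero]
    omega
  one_pos n := by
    have := hc.zero_nonpos n
    simp only [sub_self]
    omega

theorem cutComp_reverse (c : ℕ → ℤ → ℤ) (n : ℕ) (i : ℤ) :
    cutComp (fun n i => 1 - c n (1 - i)) n i = 1 - cutComp c n (1 - i) := by
  induction n generalizing i with
  | zero => simp [cutComp]
  | succ n ih =>
    simp only [cutComp, Function.comp_apply]
    rw [ih]
    simp

/-- A split morphism generates finitely many languages of two-sided sequences. -/
theorem IsSplit.finite_seqLanguage [Finite A] {s : A → List A} {e : A} {f l : A → A}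
    {u v : A → List A} (H : IsSplit s e f l u v) :
    {L | ∃ x, seqLanguage x ⊆ orbitLanguage s [e] ∧ L = seqLanguage x}.Finite := by
  have hfin := (H.finite_seqLanguage_of_isFixed.union
    (Set.finite_range fun g => orbitLanguage s [g])).union
    (H.finite_rightBoundedLanguages.union
      (H.reverse.finite_rightBoundedLanguages.image (Set.image List.reverse)))
  refine hfin.subset ?_
  rintro L ⟨x', hx', rfl⟩
  by_cases hfix : ∀ i, IsFixed s (x' i)
  · exact Or.inl (Or.inl ⟨x', hx', hfix, rfl⟩)
  push Not at hfix
  obtain ⟨i, hi⟩ := hfix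
  obtain ⟨x, hxx', hx0⟩ : ∃ x, seqLanguage x = seqLanguage x' ∧ ¬ IsFixed s (x 0) := by
    refine ⟨fun j => x' (i + j), ?_, by simpa using hi⟩
    ext t
    constructor
    · rintro ⟨j, n, rfl⟩
      exact ⟨i + j, n, by simp only [block, add_assoc]⟩
    · rintro ⟨j, n, rfl⟩
      exact ⟨j - i, n, by simp only [block]; congr 1; ext k; congr 1; ring⟩
  rw [← hxx'] at hx' ⊢
  -- Since `e` begins `s e`, every word of the language is a factor of the image of another one;
  -- desubstitution stays inside the language and can be iterated.
  have hstep : ∀ y : {y : ℤ → A // seqLanguage y ⊆ orbitLanguage s [e]},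
      ∃ (z : {y : ℤ → A // seqLanguage y ⊆ orbitLanguage s [e]}) (c : ℤ → ℤ),
        Desub s y.1 z.1 c ∧ c 0 ≤ 0 ∧ 0 < c 1 := by
    rintro ⟨y, hy⟩
    obtain ⟨z, c, h₁, h₂, h₃⟩ := exists_desub (φ := s) (L := orbitLanguage s [e])
      (fun w hw u hu => orbitLanguage_of_infix hw hu) (x := y) (by
        intro t ht
        obtain ⟨n, hn⟩ := hy ht
        refine ⟨_, ⟨n, List.infix_rfl⟩, ?_⟩
        rw [← Function.iterate_succ_apply' (wordMap s)]
        exact H.infix_succ_of_infix (Nat.le_succ n) hn)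
    exact ⟨⟨z, h₂⟩, c, h₁, h₃⟩
  choose Z C hZ hC₀ hC₁ using hstep
  let xs : ℕ → {y : ℤ → A // seqLanguage y ⊆ orbitLanguage s [e]} := fun n => Z^[n] ⟨x, hx'⟩
  have hchain : IsChain s (fun n => (xs n).1) (fun n => C (xs n)) := by
    refine ⟨fun n => ?_, fun n => hC₀ _, fun n => hC₁ _⟩
    have : xs (n + 1) = Z (xs n) := Function.iterate_succ_apply' _ _ _
    rw [this]
    exact hZ _
  by_cases hr : ∃ B, ∀ n, cutComp (fun n => C (xs n)) n 1 ≤ B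
  · exact Or.inr (Or.inl ⟨_, _, hchain, fun n => (xs n).2, hx0, hr, rfl⟩)
  by_cases hl : ∃ B, ∀ n, B ≤ cutComp (fun n => C (xs n)) n 0
  · refine Or.inr (Or.inr ⟨List.reverse '' seqLanguage x, ?_, ?_⟩)
    · refine ⟨_, _, hchain.reverse, fun n => ?_, ?_, ?_, (seqLanguage_neg x).symm⟩
      · rw [seqLanguage_neg]
        rintro _ ⟨t, ht, rfl⟩
        exact reverse_mem_orbitLanguage ((xs n).2 ht)
      · rw [isFixed_revMap]
        exact hx0
      · obtain ⟨B, hB⟩ := hl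
        refine ⟨1 - B, fun n => ?_⟩
        rw [cutComp_reverse, sub_self]
        have := hB n
        omega
    · rw [Set.image_image]
      simp
  · push Not at hr hl
    obtain ⟨g, hg⟩ := hchain.exists_seqLanguage_eq H hl hr
    exact Or.inl (Or.inr ⟨g, hg.symm⟩)

end Reversal

/-! ### Powers of a morphism -/

section IteratePowers

/-- The orbit is eventually periodic, and any multiple of the period that exceeds the preperiod is
an idempotent time. The factor `m` allows a common time for several points. -/
theorem exists_iterate_idem {X : Type*} (f : X → X) {x : X}
    (h : (Set.range fun n => f^[n] x).Finite) :
    ∃ p > 0, ∀ m > 0, f^[p * m] (f^[p * m] x) = f^[p * m] x := by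
  obtain ⟨i, j, hij, heq⟩ : ∃ i j, i < j ∧ f^[i] x = f^[j] x := by
    have hninj : ¬ Function.Injective fun n => f^[n] x := fun hi =>
      Set.infinite_range_of_injective hi h
    simp only [Function.Injective, not_forall] at hninj
    obtain ⟨i, j, h₁, h₂⟩ := hninj
    rcases lt_or_gt_of_ne h₂ with h₃ | h₃
    · exact ⟨i, j, h₃, h₁⟩
    · exact ⟨j, i, h₃, h₁.symm⟩
  obtain ⟨d, rfl⟩ := Nat.exists_eq_add_of_lt hij
  have hper : ∀ n ≥ i, f^[n + (d + 1)] x = f^[n] x := by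
    intro n hn
    obtain ⟨k, rfl⟩ := Nat.exists_eq_add_of_le hn
    rw [show i + k + (d + 1) = k + (i + d + 1) by ring, Function.iterate_add_apply, ← heq,
      ← Function.iterate_add_apply, add_comm]
  have hper' : ∀ k, ∀ n ≥ i, f^[n + k * (d + 1)] x = f^[n] x := by
    intro k n hn
    induction k with
    | zero => simp
    | succ k ih => rw [Nat.succ_mul, ← add_assoc, hper _ (by omega), ih]
  refine ⟨(d + 1) * (i + 1), by positivity, fun m hm => ?_⟩
  rw [← Function.iterate_add_apply]
  have h₁ := hper' ((i + 1) * m) ((d + 1) * (i + 1) * m) (by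
    calc i ≤ 1 * (i + 1) * 1 := by omega
      _ ≤ (d + 1) * (i + 1) * m := by gcongr <;> omega)
  rw [← h₁]
  congr 2
  ring

theorem exists_iterate_idem_of_finite {X ι : Type*} [Finite ι] (f : X → X) (x : ι → X)
    (h : ∀ i, (Set.range fun n => f^[n] (x i)).Finite) :
    ∃ p > 0, ∀ m > 0, ∀ i, f^[p * m] (f^[p * m] (x i)) = f^[p * m] (x i) := by
  have := Fintype.ofFinite ι
  choose p hp hpm using fun i => exists_iterate_idem f (h i)
  refine ⟨∏ i, p i, Finset.prod_pos fun i _ => hp i, fun m hm i => ?_⟩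
  obtain ⟨k, hk⟩ := Finset.dvd_prod_of_mem p (Finset.mem_univ i)
  have hk0 : 0 < k := by
    rcases Nat.eq_zero_or_pos k with rfl | hk0
    · have := Finset.prod_pos (s := Finset.univ) fun i _ => hp i
      omega
    · exact hk0
  rw [hk, mul_assoc]
  exact hpm i _ (Nat.mul_pos hk0 hm)

variable {A : Type*}

/-- The first letter that is not fixed, under iteration. -/
theorem iterate_first {s : A → List A} {f : A → A} {u : A → List A}
    (hf : ∀ g, ¬ IsFixed s g → (∀ c ∈ u g, IsFixed s c) ∧ ¬ IsFixed s (f g) ∧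
      ∃ r, s g = u g ++ f g :: r) {g : A} (hg : ¬ IsFixed s g) (n : ℕ) :
    ¬ IsFixed s (f^[n] g) ∧ ∃ t r, (∀ c ∈ t, IsFixed s c) ∧
      (wordMap s)^[n] [g] = t ++ f^[n] g :: r := by
  induction n with
  | zero => exact ⟨hg, [], [], by simp, rfl⟩
  | succ n ih =>
    obtain ⟨h₁, t, r, h₂, h₃⟩ := ih
    obtain ⟨h₄, h₅, r', h₆⟩ := hf _ h₁
    rw [Function.iterate_succ_apply', Function.iterate_succ_apply', h₃]
    refine ⟨h₅, t ++ u (f^[n] g), r' ++ wordMap s r, ?_, ?_⟩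
    · intro c hc
      rcases List.mem_append.1 hc with hc | hc
      · exact h₂ c hc
      · exact h₄ c hc
    · rw [wordMap_append, wordMap_of_fixed h₂, wordMap_cons, h₆]
      simp

/-- The set of letters of the iterated images of a letter, as an iteration on sets. -/
theorem mem_iterate_letters (s : A → List A) (n : ℕ) (w : List A) :
    (fun U : Set A => {b | ∃ a ∈ U, b ∈ s a})^[n] {a | a ∈ w} =
      {b | b ∈ (wordMap s)^[n] w} := by
  induction n with
  | zero => rfl
  | succ n ih =>
    rw [Function.iterate_succ_apply', ih, Function.iterate_succ_apply']
    ext b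
    simp [mem_wordMap]

/-- A morphism with a seed, all of whose letters are fixed or never return to themselves alone,
generates finitely many languages of two-sided sequences. -/
theorem finite_seqLanguage_of_seed [Finite A] {s : A → List A} {e : A}
    (he : ∃ m, s e = e :: (m ++ [e])) (hs : ∀ a, ¬ IsFixed s a → ∃ b ∈ s a, ¬ IsFixed s b)
    (hs' : ∀ a, ¬ IsFixed s a → ∀ n, (wordMap s)^[n + 1] [a] ≠ [a]) :
    {L | ∃ x, seqLanguage x ⊆ orbitLanguage s [e] ∧ L = seqLanguage x}.Finite := by
  have hf : ∃ (f : A → A) (u : A → List A), ∀ g, ¬ IsFixed s g →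
      (∀ c ∈ u g, IsFixed s c) ∧ ¬ IsFixed s (f g) ∧ ∃ r, s g = u g ++ f g :: r := by
    have : ∀ g, ∃ (b : A) (t : List A), ¬ IsFixed s g →
        (∀ c ∈ t, IsFixed s c) ∧ ¬ IsFixed s b ∧ ∃ r, s g = t ++ b :: r := fun g => by
      by_cases hg : IsFixed s g
      · exact ⟨g, [], fun h => absurd hg h⟩
      · obtain ⟨t, b, r, h₁, h₂, h₃⟩ := exists_first_of_exists (hs g hg)
        exact ⟨b, t, fun _ => ⟨h₂, h₃, r, h₁⟩⟩
    choose f u h using this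
    exact ⟨f, u, h⟩
  have hl : ∃ (f : A → A) (u : A → List A), ∀ g, ¬ IsFixed (revMap s) g →
      (∀ c ∈ u g, IsFixed (revMap s) c) ∧ ¬ IsFixed (revMap s) (f g) ∧
        ∃ r, revMap s g = u g ++ f g :: r := by
    have : ∀ g, ∃ (b : A) (t : List A), ¬ IsFixed (revMap s) g →
        (∀ c ∈ t, IsFixed (revMap s) c) ∧ ¬ IsFixed (revMap s) b ∧
          ∃ r, revMap s g = t ++ b :: r := fun g => by
      by_cases hg : IsFixed (revMap s) g
      · exact ⟨g, [], fun h => absurd hg h⟩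
      · obtain ⟨t, b, r, h₁, h₂, h₃⟩ := exists_first_of_exists (P := IsFixed (revMap s))
          (w := revMap s g) (by
            obtain ⟨b, hb, hb'⟩ := hs g (fun h => hg (isFixed_revMap.2 h))
            exact ⟨b, List.mem_reverse.2 hb, fun h => hb' (isFixed_revMap.1 h)⟩)
        exact ⟨b, t, fun _ => ⟨h₂, h₃, r, h₁⟩⟩
    choose f u h using this
    exact ⟨f, u, h⟩
  obtain ⟨f, u, hf⟩ := hf
  obtain ⟨l, v, hl⟩ := hl
  -- Idempotence of `D` on singletons will make recurrent letters recur at once.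
  let D : Set A → Set A := fun U => {b | ∃ a ∈ U, b ∈ s a}
  obtain ⟨p₁, hp₁, hp₁'⟩ := exists_iterate_idem_of_finite f id fun _ => Set.toFinite _
  obtain ⟨p₂, hp₂, hp₂'⟩ := exists_iterate_idem_of_finite l id fun _ => Set.toFinite _
  obtain ⟨p₃, hp₃, hp₃'⟩ := exists_iterate_idem_of_finite D (fun a : A => {b | b ∈ [a]})
    fun _ => Set.toFinite _
  let q : ℕ := p₁ * p₂ * p₃
  have hq : 0 < q := by positivity
  have hqf : ∀ a, f^[q] (f^[q] a) = f^[q] a := fun a => by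
    have := hp₁' (p₂ * p₃) (by positivity) a
    rwa [← mul_assoc] at this
  have hql : ∀ a, l^[q] (l^[q] a) = l^[q] a := fun a => by
    have := hp₂' (p₁ * p₃) (by positivity) a
    rwa [show p₂ * (p₁ * p₃) = q by simp only [q]; ring] at this
  have hqD : ∀ a : A, D^[q] (D^[q] {b | b ∈ [a]}) = D^[q] {b | b ∈ [a]} := fun a => by
    have := hp₃' (p₁ * p₂) (by positivity) a
    rwa [show p₃ * (p₁ * p₂) = q by simp only [q]; ring] at this
  obtain ⟨q', hq'⟩ : ∃ q', q = q' + 1 := ⟨q - 1, by omega⟩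
  let S : A → List A := fun a => (wordMap s)^[q] [a]
  have hS : wordMap S = (wordMap s)^[q] := (iterate_wordMap_eq s q).symm
  have hSn : ∀ n, (wordMap S)^[n] = (wordMap s)^[q * n] := fun n => by
    rw [hS, ← Function.iterate_mul]
  -- By `hs'`, passing to a power creates no new fixed letters.
  have hfixS : ∀ a, IsFixed S a ↔ IsFixed s a := by
    intro a
    constructor
    · intro h
      by_contra hn
      refine hs' a hn q' ?_
      rw [← hq']
      exact h
    · intro h
      change (wordMap s)^[q] [a] = [a]
      exact Function.iterate_fixed (by rw [wordMap_singleton]; exact h) _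
  have hfirst : ∀ g, ∃ t, ¬ IsFixed S g →
      (∀ c ∈ t, IsFixed S c) ∧ ∃ r, S g = t ++ f^[q] g :: r := fun g => by
    by_cases hg : IsFixed S g
    · exact ⟨[], fun h => absurd hg h⟩
    · obtain ⟨-, t, r, h₁, h₂⟩ := iterate_first hf (fun h => hg ((hfixS g).2 h)) q
      exact ⟨t, fun _ => ⟨fun c hc => (hfixS c).2 (h₁ c hc), r, h₂⟩⟩
  have hlast : ∀ g, ∃ t, ¬ IsFixed S g →
      (∀ c ∈ t, IsFixed S c) ∧ ∃ r, S g = r ++ l^[q] g :: t := fun g => by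
    by_cases hg : IsFixed S g
    · exact ⟨[], fun h => absurd hg h⟩
    · obtain ⟨-, t, r, h₁, h₂⟩ := iterate_first hl
        (fun h => hg ((hfixS g).2 (isFixed_revMap.1 h))) q
      refine ⟨t.reverse, fun _ => ⟨fun c hc =>
        (hfixS c).2 (isFixed_revMap.1 (h₁ c (List.mem_reverse.1 hc))), r.reverse, ?_⟩⟩
      have h₃ := iterate_wordMap_revMap s q [g]
      rw [List.reverse_singleton, h₂] at h₃
      have h₄ := congrArg List.reverse h₃
      rw [List.reverse_reverse] at h₄
      simpa [S] using h₄.symm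
  choose u' hu' using hfirst
  choose v' hv' using hlast
  have hseed : ∀ n, ∃ m, (wordMap s)^[n + 1] [e] = e :: (m ++ [e]) := by
    obtain ⟨m, hm⟩ := he
    intro n
    induction n with
    | zero => exact ⟨m, by simpa using hm⟩
    | succ n ih =>
      obtain ⟨m', hm'⟩ := ih
      rw [Function.iterate_succ_apply', hm']
      exact ⟨m ++ e :: (wordMap s m' ++ (e :: m)), by simp [hm]⟩
  have H : IsSplit S e f^[q] l^[q] u' v' :=
    { first := hu'
      first_moving := fun g hg h => (iterate_first hf (fun h => hg ((hfixS g).2 h)) q).1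
        ((hfixS _).1 h)
      first_idem := hqf
      last := hv'
      last_moving := fun g hg h => (iterate_first hl
        (fun h => hg ((hfixS g).2 (isFixed_revMap.1 h))) q).1 (isFixed_revMap.2 ((hfixS _).1 h))
      last_idem := hql
      seed := by
        obtain ⟨m, hm⟩ := hseed q'
        rw [← hq'] at hm
        exact ⟨m, hm⟩
      recurrent := fun g n hg => by
        rw [hSn] at hg
        have h₁ : ∀ n, D^[q * (n + 1)] {b | b ∈ [g]} = D^[q] {b | b ∈ [g]} := by
          intro n
          induction n with
          | zero => rw [zero_add, mul_one]
          | succ n ih => rw [mul_add, mul_one, add_comm, Function.iterate_add_apply, ih, hqD]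
        have h₂ : g ∈ D^[q * (n + 1)] {b | b ∈ [g]} := by
          rw [mem_iterate_letters]
          exact hg
        rw [h₁, mem_iterate_letters] at h₂
        exact h₂ }
  refine H.finite_seqLanguage.subset ?_
  rintro L ⟨x, hx, rfl⟩
  refine ⟨x, hx.trans ?_, rfl⟩
  rintro t ⟨n, hn⟩
  refine ⟨n, ?_⟩
  rw [hSn]
  obtain ⟨m, hm⟩ := he
  exact hn.trans (iterate_wordMap_infix_of_le ⟨[], m ++ [e], by simp [hm]⟩
    (Nat.le_mul_of_pos_left n hq))

end IteratePowers

/-! ### Reduction of an arbitrary endomorphism -/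

section Reduction

variable {A : Type*}

/-- A letter with finitely many iterated images. -/
def IsBounded (s : A → List A) (a : A) : Prop :=
  (Set.range fun n => (wordMap s)^[n] [a]).Finite

theorem finite_range_iterate_of_isBounded {s : A → List A} {w : List A}
    (h : ∀ a ∈ w, IsBounded s a) : (Set.range fun n => (wordMap s)^[n] w).Finite := by
  induction w with
  | nil =>
    refine (Set.finite_singleton []).subset ?_
    rintro _ ⟨n, rfl⟩
    simp
  | cons a w ih =>
    refine ((h a (by simp)).image2 (· ++ ·) (ih fun b hb => h b (by simp [hb]))).subset ?_
    rintro _ ⟨n, rfl⟩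
    refine ⟨_, ⟨n, rfl⟩, _, ⟨n, rfl⟩, ?_⟩
    simp only
    rw [← iterate_wordMap_append]
    rfl

theorem finite_range_iterate_of_shift {X : Type*} {f : X → X} {x : X} (p : ℕ)
    (h : (Set.range fun n => f^[n] (f^[p] x)).Finite) : (Set.range fun n => f^[n] x).Finite := by
  refine (((Set.finite_Iio p).image fun n => f^[n] x).union h).subset ?_
  rintro _ ⟨n, rfl⟩
  rcases lt_or_ge n p with hn | hn
  · exact Or.inl ⟨n, hn, rfl⟩
  · obtain ⟨k, rfl⟩ := Nat.exists_eq_add_of_le hn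
    refine Or.inr ⟨k, ?_⟩
    simp only
    rw [← Function.iterate_add_apply, add_comm]

theorem finite_range_iterate_of_eq {X : Type*} {f : X → X} {x : X} {p n : ℕ} (hn : 0 < n)
    (h : f^[p + n] x = f^[p] x) : (Set.range fun n => f^[n] x).Finite := by
  refine ((Set.finite_Iio (p + n)).image fun k => f^[k] x).subset ?_
  rintro _ ⟨k, rfl⟩
  induction k using Nat.strong_induction_on with
  | _ k ih =>
    rcases lt_or_ge k (p + n) with hk | hk
    · exact ⟨k, hk, rfl⟩
    · obtain ⟨d, rfl⟩ := Nat.exists_eq_add_of_le hk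
      have h₁ : f^[p + n + d] x = f^[p + d] x := by
        rw [add_comm (p + n) d, add_comm p d, Function.iterate_add_apply f d, h,
          ← Function.iterate_add_apply]
      obtain ⟨m, hm, hm'⟩ := ih (p + d) (by omega)
      exact ⟨m, hm, hm'.trans h₁.symm⟩

open Classical in
/-- For every endomorphism, the sequences in its shift are morphic images of the sequences in the
shift of a morphism whose letters are fixed or growing. -/
theorem finite_seqLanguage_of_map [Finite A] (s : A → List A) :
    {L | ∃ x, (∀ t ∈ seqLanguage x, ∃ n a, t <:+: (wordMap s)^[n] [a]) ∧
      L = seqLanguage x}.Finite := by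
  rcases isEmpty_or_nonempty A with hA | ⟨⟨a₀⟩⟩
  · refine Set.Finite.subset Set.finite_empty ?_
    rintro L ⟨x, -⟩
    exact (hA.false (x 0)).elim
  obtain ⟨p, hp, hpm⟩ := exists_iterate_idem_of_finite (ι := {a // IsBounded s a}) (wordMap s)
    (fun a => [a.1]) fun a => a.2
  have hpb : ∀ a, IsBounded s a → (wordMap s)^[p] ((wordMap s)^[p] [a]) = (wordMap s)^[p] [a] :=
    fun a ha => by simpa using hpm 1 one_pos ⟨a, ha⟩
  let τ : A → List A := fun a => (wordMap s)^[p] [a]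
  have hτ : wordMap τ = (wordMap s)^[p] := (iterate_wordMap_eq s p).symm
  -- On bounded letters `τ ∘ τ = τ`, so freezing them is invisible after one more `τ`: this is
  -- `hτκ`.
  let κ : A → List A := fun a => if IsBounded s a then [a] else τ a
  -- Letters killed by `τ` are deleted, so that `ρ` never erases.
  let π : A → List (Option A) := fun a => if τ a = [] then [] else [some a]
  have hW : (Set.range fun ia : Fin p × A => (wordMap s)^[ia.1.1] [ia.2]).Finite :=
    Set.finite_range _
  let ws : List (List A) := hW.toFinset.toList
  -- The extra letter `none` is the seed: its image lists all iterates of exponent less than `p`,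
  -- the remainders of division of the exponent by `p`.
  let ρ : Option A → List (Option A) := fun b =>
    match b with
    | none => none :: (ws.flatMap (wordMap π) ++ [none])
    | some a => if IsBounded s a then [some a] else wordMap π (τ a)
  -- The value on killed letters only serves to make `φ` nonerasing; they do not occur in images of
  -- `π`.
  let φ : Option A → List A := fun b =>
    match b with
    | none => [a₀]
    | some a => if τ a = [] then [a] else τ a
  have hφ : ∀ b, φ b ≠ [] := by
    rintro (_ | a)
    · simp [φ]
    · by_cases h : τ a = []
      · simp [φ, h]
      · simp [φ, h]
  have hnil : ∀ a, ¬ IsBounded s a → τ a ≠ [] := fun a ha h => ha <| by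
    refine finite_range_iterate_of_shift p ?_
    rw [show (wordMap s)^[p] [a] = [] from h]
    exact finite_range_iterate_of_isBounded (by simp)
  have hφπ : ∀ w, wordMap φ (wordMap π w) = wordMap τ w := fun w => by
    rw [wordMap_wordMap]
    refine wordMap_congr fun a _ => ?_
    by_cases h : τ a = []
    · simp [π, h]
    · simp [π, φ, h]
  have hτκ : ∀ w, wordMap τ (wordMap κ w) = wordMap τ (wordMap τ w) := fun w => by
    rw [wordMap_wordMap, wordMap_wordMap]
    refine wordMap_congr fun a _ => ?_
    by_cases h : IsBounded s a
    · simp only [κ, if_pos h, wordMap_singleton]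
      rw [hτ]
      exact (hpb a h).symm
    · simp only [κ, if_neg h]
  have hτκn : ∀ n w, wordMap τ ((wordMap κ)^[n] w) = (wordMap τ)^[n + 1] w := fun n => by
    induction n with
    | zero => exact fun w => rfl
    | succ n ih =>
      intro w
      rw [Function.iterate_succ_apply', hτκ, ih, ← Function.iterate_succ_apply' (wordMap τ)]
  have hρπ : ∀ w, wordMap ρ (wordMap π w) = wordMap π (wordMap κ w) := fun w => by
    rw [wordMap_wordMap, wordMap_wordMap]
    refine wordMap_congr fun a _ => ?_
    by_cases h : IsBounded s a
    · by_cases h' : τ a = []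
      · simp [π, κ, h, h']
      · simp [π, κ, ρ, h, h']
    · simp [π, κ, ρ, h, hnil a h]
  have hρπn : ∀ n w, (wordMap ρ)^[n] (wordMap π w) = wordMap π ((wordMap κ)^[n] w) := fun n => by
    induction n with
    | zero => exact fun w => rfl
    | succ n ih =>
      intro w
      rw [Function.iterate_succ_apply, hρπ, ih, Function.iterate_succ_apply]
  have hφρ : ∀ n w, wordMap φ ((wordMap ρ)^[n] (wordMap π w)) = (wordMap τ)^[n + 1] w :=
    fun n w => by rw [hρπn, hφπ, hτκn]
  have hunb : ∀ a, ¬ IsBounded s a → ∀ n, (wordMap ρ)^[n + 1] [some a] ≠ [some a] := by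
    intro a ha n h
    have hπ : wordMap π [a] = [some a] := by simp [π, hnil a ha]
    have h₁ := hφρ (n + 1) [a]
    rw [hπ, h, ← hπ, hφπ, hτ, ← Function.iterate_mul] at h₁
    refine ha (finite_range_iterate_of_eq (p := p) (n := p * (n + 1)) (by positivity) ?_)
    rw [h₁]
    congr 1
    ring_nf
  have hfix : ∀ a, IsFixed ρ (some a) ↔ IsBounded s a := fun a => by
    constructor
    · intro h
      by_contra ha
      exact hunb a ha 0
        ((wordMap_singleton ρ (some a)).trans (show ρ (some a) = [some a] from h))
    · intro h
      simp [IsFixed, ρ, h]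
  have hseed : ∃ m, ρ none = none :: (m ++ [none]) := ⟨_, rfl⟩
  have hnone : ¬ IsFixed ρ none := fun h => by simp [IsFixed, ρ] at h
  have hcore := finite_seqLanguage_of_seed (s := ρ) (e := none) hseed
    (by
      rintro (_ | a) ha
      · exact ⟨none, by simp [ρ], hnone⟩
      · rw [hfix] at ha
        obtain ⟨b, hb, hb'⟩ : ∃ b ∈ τ a, ¬ IsBounded s b := by
          by_contra hcon
          push Not at hcon
          exact ha (finite_range_iterate_of_shift p (finite_range_iterate_of_isBounded hcon))
        refine ⟨some b, ?_, fun h => hb' ((hfix b).1 h)⟩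
        simp only [ρ, if_neg ha]
        exact mem_wordMap.2 ⟨b, hb, by simp [π, hnil b hb']⟩)
    (by
      rintro (_ | a) ha n h
      · obtain ⟨m, hm⟩ := hseed
        have h₁ : [none, none].Sublist ((wordMap ρ)^[n + 1] [none]) := by
          clear h
          induction n with
          | zero => simp [hm]
          | succ n ih =>
            rw [Function.iterate_succ_apply']
            have h₂ : none ∈ (wordMap ρ)^[n + 1] [none] := ih.subset (by simp)
            obtain ⟨q, r, hqr⟩ := List.append_of_mem h₂
            rw [hqr, wordMap_append, wordMap_cons, hm]
            refine List.Sublist.trans ?_ (List.sublist_append_right _ _)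
            refine List.Sublist.trans ?_ (List.sublist_append_left _ _)
            simp
        have h₂ := h₁.length_le
        rw [h] at h₂
        simp at h₂
      · rw [hfix] at ha
        exact hunb a ha n h)
  refine (hcore.image fun K => {t | ∃ w ∈ K, t <:+: wordMap φ w}).subset ?_
  rintro L ⟨x, hx, rfl⟩
  obtain ⟨B, hB⟩ := (Set.finite_range fun ia : Fin p × A =>
    ((wordMap s)^[ia.1.1] [ia.2]).length).bddAbove
  obtain ⟨y, c, hd, hy, -, -⟩ := exists_desub (φ := φ) (L := orbitLanguage ρ [none])
    (fun w hw u hu => orbitLanguage_of_infix hw hu) (x := x) (by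
      intro t ht
      -- The added length excludes iterates of exponent below `p`.
      obtain ⟨⟨r, hr, hr'⟩, -⟩ := exists_extension ht (B + 1)
      obtain ⟨n, a, hna⟩ := hx _ hr'
      have hnp : p ≤ n := by
        by_contra hlt
        have h₁ := hB ⟨(⟨n, by omega⟩, a), rfl⟩
        have h₂ := hna.length_le
        simp only [List.length_append] at h₁ h₂
        omega
      have hdm := Nat.div_add_mod n p
      -- One application of `τ` is carried out by `φ` after `π`, the other `k` by `ρ`.
      obtain ⟨k, hk⟩ : ∃ k, n / p = k + 1 :=
        ⟨n / p - 1, by have := Nat.div_pos hnp hp; omega⟩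
      rw [hk] at hdm
      let w : List A := (wordMap s)^[n % p] [a]
      have hw : (wordMap s)^[n] [a] = (wordMap τ)^[k + 1] w := by
        rw [hτ, ← Function.iterate_mul, ← Function.iterate_add_apply, hdm]
      have hww : w ∈ ws := by
        simp only [ws, Finset.mem_toList, Set.Finite.mem_toFinset]
        exact ⟨(⟨n % p, Nat.mod_lt _ hp⟩, a), rfl⟩
      have hinf : wordMap π w <:+: wordMap ρ [none] := by
        obtain ⟨q, r, hqr⟩ := List.append_of_mem hww
        rw [wordMap_singleton]
        exact ⟨none :: q.flatMap (wordMap π), r.flatMap (wordMap π) ++ [none], by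
          simp [ρ, hqr]⟩
      refine ⟨(wordMap ρ)^[k] (wordMap π w), ⟨k + 1, iterate_wordMap_infix ρ k hinf⟩, ?_⟩
      rw [hφρ, ← hw]
      exact (List.prefix_append t r).isInfix.trans hna)
  exact ⟨seqLanguage y, ⟨y, hy, rfl⟩, (hd.seqLanguage_eq hφ).symm⟩

theorem toList_monoidEnd (σ : Monoid.End (FreeMonoid A)) (w : FreeMonoid A) :
    FreeMonoid.toList (σ w) =
      wordMap (fun a => FreeMonoid.toList (σ (FreeMonoid.of a))) (FreeMonoid.toList w) := by
  induction w using FreeMonoid.recOn with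
  | one => simp
  | of_mul a w ih => simp [ih]

theorem toList_monoidEnd_pow (σ : Monoid.End (FreeMonoid A)) (n : ℕ) (a : A) :
    FreeMonoid.toList ((σ ^ n) (FreeMonoid.of a)) =
      (wordMap fun a => FreeMonoid.toList (σ (FreeMonoid.of a)))^[n] [a] := by
  induction n with
  | zero => rfl
  | succ n ih =>
    rw [Function.iterate_succ_apply', ← ih, ← toList_monoidEnd, pow_succ']
    rfl

theorem finite_seqLanguage_substitutionShift [Finite A] [TopologicalSpace A]
    [DiscreteTopology A] (σ : Monoid.End (FreeMonoid A)) :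
    {L : Set (List A) | ∃ x ∈ (substitutionShift σ).carrier, L = seqLanguage x}.Finite := by
  refine (finite_seqLanguage_of_map
    fun a => FreeMonoid.toList (σ (FreeMonoid.of a))).subset ?_
  rintro L ⟨x, hx, rfl⟩
  refine ⟨x, fun t ht => ?_, rfl⟩
  obtain ⟨n, a, h⟩ := hx ht
  exact ⟨n, a, by rwa [← toList_monoidEnd_pow]⟩

end Reduction

/-! ### Subshifts and languages -/

section Subshifts

variable {A : Type*} [TopologicalSpace A]

/-- A subshift contains every sequence whose language is contained in that of one of its points. -/
theorem mem_subshift_of_seqLanguage_subset (Y : Subshift A ℤ) {x y : ℤ → A}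
    (hx : x ∈ Y.carrier) (h : seqLanguage y ⊆ seqLanguage x) : y ∈ Y.carrier := by
  have hN : ∀ N : ℕ, ∃ i, ∀ k : ℤ, -N ≤ k → k < N → x (i + k) = y k := by
    intro N
    obtain ⟨i, n, hi⟩ := h ⟨-N, N + N, rfl⟩
    have hn : N + N = n := by simpa using congrArg List.length hi
    subst hn
    refine ⟨i + N, fun k h₁ h₂ => ?_⟩
    obtain ⟨j, hj⟩ := Int.eq_ofNat_of_zero_le (show 0 ≤ k + N by omega)
    have h₃ := List.getElem_of_eq hi (i := j) (by simp; omega)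
    simp only [getElem_block] at h₃
    rw [show i + N + k = i + j by omega, ← h₃]
    congr 1
    omega
  choose i hi using hN
  refine Y.isClosed.mem_of_tendsto (b := Filter.atTop) (f := fun N => shift (i N) x) ?_
    (Filter.Eventually.of_forall fun N => Y.mapsTo (i N) hx)
  rw [tendsto_pi_nhds]
  intro k
  refine tendsto_const_nhds.congr' ?_
  filter_upwards [Filter.eventually_ge_atTop (k.natAbs + 1)] with N hN
  rw [shift_apply]
  exact (hi N k (by omega) (by omega)).symm

/-- Sending a subshift to the set of languages of its points is injective, with values in the
subsets of a finite set. -/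
theorem quasiMinimal_of_finite_seqLanguage {X : Subshift A ℤ}
    (h : {L : Set (List A) | ∃ x ∈ X.carrier, L = seqLanguage x}.Finite) : QuasiMinimal X := by
  refine Set.Finite.of_finite_image (f := fun Y : Subshift A ℤ => seqLanguage '' Y.carrier)
    (h.finite_subsets.subset ?_) ?_
  · rintro _ ⟨Y, hY, rfl⟩ _ ⟨x, hx, rfl⟩
    exact ⟨x, hY hx, rfl⟩
  · have hle : ∀ Y Z : Subshift A ℤ, seqLanguage '' Y.carrier = seqLanguage '' Z.carrier →
        Y.carrier ⊆ Z.carrier := by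
      intro Y Z hYZ y hy
      have : seqLanguage y ∈ seqLanguage '' Z.carrier := hYZ ▸ ⟨y, hy, rfl⟩
      obtain ⟨z, hz, hzy⟩ := this
      exact mem_subshift_of_seqLanguage_subset Z hz hzy.ge
    rintro Y - Z - hYZ
    have hc : Y.carrier = Z.carrier := (hle Y Z hYZ).antisymm (hle Z Y hYZ.symm)
    cases Y
    cases Z
    simpa using hc

end Subshifts

end SubstShift

theorem mainTheorem7 {A : Type*} [Finite A] [TopologicalSpace A] [DiscreteTopology A]
    (σ : Monoid.End (FreeMonoid A)) :
    SubstShift.QuasiMinimal (SubstShift.substitutionShift σ) ∧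
      {L : Set (List A) | ∃ x ∈ (SubstShift.substitutionShift σ).carrier,
        L = SubstShift.seqLanguage x}.Finite :=
  ⟨SubstShift.quasiMinimal_of_finite_seqLanguage
      (SubstShift.finite_seqLanguage_substitutionShift σ),
    SubstShift.finite_seqLanguage_substitutionShift σ⟩
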